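/- **Setting.** A Bell scenario $\mathcal B=(\mathsf N,\mathsf M,\rho)$ consists of local measurements $\{N_{a|x}\}_a$ of a first party, $\{M_{b|y}\}_b$ of a second party, and a bipartite quantum state $\rho$ (all finite-dimensional). For an indexed family of operators $E=(E_{a|x})$ let $\mathcal O_{\rm all}(E)$ be the set of all real vectors $(\alpha_{a,x})$ with $\sum_{a,x}\alpha_{a,x}E_{a|x}=0$, and let $\mathcal O_{\rm triv}(E)$ be the linear span of the vectors belonging to the identities $\sum_aE_{a|x}=\sum_aE_{a|x'}$. For letters $i,j,u,v\in\{{\rm a},{\rm t}\}$ (a = all, t = trivial) let $\mathcal O_{ijuv}$ be the (labelled) union of $\mathcal O_i(\mathsf N)$, $\mathcal O_j(\mathsf M)$, $\mathcal O_u(\mathsf N\circ\rho)$, $\mathcal O_v(\mathsf M\circ\rho)$, where $\mathsf N\circ\rho=({\rm Tr}_A[(N_{a|x}\otimes 1)\rho])$ and $\mathsf M\circ\rho=({\rm Tr}_B[(1\otimes M_{b|y})\rho])$. $\mathcal{NC}_{ijuv}$ is the set of all $(p(ab|xy))_{a,b,x,y}$ of the form $p(ab|xy)=\sum_{\lambda_A,\lambda_B}p(\lambda_A\lambda_B)\,p(a|x,\lambda_A)\,p(b|y,\lambda_B)$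 (finite sums, probability distributions) such that $\sum\alpha_{a,x}p(a|x,\lambda_A)=0$ for all $\lambda_A$ and $\alpha\in\mathcal O_i(\mathsf N)$; $\sum\beta_{b,y}p(b|y,\lambda_B)=0$ for all $\lambda_B$ and $\beta\in\mathcal O_j(\mathsf M)$; $\sum\alpha_{a,x}\sum_{\lambda_A}p(a|x,\lambda_A)p(\lambda_A\lambda_B)=0$ for all $\lambda_B$ and $\alpha\in\mathcal O_u(\mathsf N\circ\rho)$; and $\sum\beta_{b,y}\sum_{\lambda_B}p(b|y,\lambda_B)p(\lambda_A\lambda_B)=0$ for all $\lambda_A$ and $\beta\in\mathcal O_v(\mathsf M\circ\rho)$. Put $\hat m_0=(1,0,0)$, $\hat m_1=(0,1,0)$, $\hat m_2=(0,0,1)$ and $\hat n_0=\frac1{\sqrt3}(1,1,1)$, $\hat n_1=\frac1{\sqrt3}(1,1,-1)$, $\hat n_2=\frac1{\sqrt3}(1,-1,1)$, $\hat n_3=\frac1{\sqrt3}(1,-1,-1)$. An (octahedron, cube) scenario is one with $a,b\in\{0,1\}$, $x\in\{0,1,2\}$, $y\in\{0,1,2,3\}$ in which $\mathcal O_{\rm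 all}(\mathsf N)$ is the set of affine dependencies of the octahedron vertices $(-1)^a\hat m_x$ and $\mathcal O_{\rm all}(\mathsf M)$ is that of the cube vertices $(-1)^b\hat n_y$. **Theorem.** (i) In every (octahedron, cube) scenario, $\mathcal O_{\rm aatt}=\mathcal O_{\rm tatt}\supsetneq\mathcal O_{\rm attt}=\mathcal O_{\rm tttt}$ and $$\mathcal{NC}_{\rm aatt}=\mathcal{NC}_{\rm tatt}\subsetneq\mathcal{NC}_{\rm attt}=\mathcal{NC}_{\rm tttt}.$$ In every (cube, octahedron) scenario (parties exchanged), $\mathcal O_{\rm aatt}=\mathcal O_{\rm attt}\supsetneq\mathcal O_{\rm tatt}=\mathcal O_{\rm tttt}$ and $\mathcal{NC}_{\rm aatt}=\mathcal{NC}_{\rm attt}\subsetneq\mathcal{NC}_{\rm tatt}=\mathcal{NC}_{\rm tttt}$. (ii) In every (octahedron, cube) scenario, $\mathcal{NC}_{\rm aatt}\subset\mathbb R^{48}$ is a polytope whose affine span has dimension $15$. It has exactly $336$ nontrivial facets, i.e. facets not of the form $\{p\in\mathcal{NC}_{\rm aatt}: p(ab|xy)=0\}$. Each of the inequalities 1.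 $p(01|22)+p(10|03)-p(11|00)+p(11|21)\ge0$, 2. $p(01|22)+p(10|03)-p(11|00)+p(11|20)\ge0$, 3. $p(01|22)+p(10|03)-p(11|00)+p(11|10)-p(11|12)-p(11|20)+p(11|21)+p(11|22)\ge0$ is valid on $\mathcal{NC}_{\rm aatt}$ and defines a nontrivial facet. The orbits of these three facets under the relabelings of settings and outcomes of the two parties that preserve $\mathcal O_{\rm all}(\mathsf N)$ and $\mathcal O_{\rm all}(\mathsf M)$ are pairwise disjoint, have $144$, $144$ and $48$ elements respectively, and together are all the nontrivial facets. (iii) Let $\sigma=(\sigma_x,\sigma_y,\sigma_z)$ be the Pauli matrices, $N_{a|x}=\frac12(1+(-1)^a\hat m_x\cdot\sigma)$, $M_{b|y}=\frac12(1+(-1)^b\hat n_y\cdot\sigma)$, and for $0\le p\le1$ let $\rho^p_{\rm Iso}=p|\Phi^+\rangle\langle\Phi^+|+(1-p)\frac{1}{4}$ with $|\Phi^+\rangle=(|00\rangle+|11\rangle)/\sqrt2$. This is an (octahedron, cube) scenario, and the statistics ${\rm Tr}[\rho^p_{\rm Iso}(N_{a|x}\otimes M_{b|y})]$ violate inequality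 3 if and only if $p>1/\sqrt3$; in particular they lie outside $\mathcal{NC}_{\rm aatt}$ for these $p$. -/

import Mathlib

open scoped Matrix Kronecker ComplexOrder

namespace NCBell

/-! ### Bell scenarios and their operational identities -/

/-- Operational statistics: `p a b x y` is `p(ab|xy)`, a point of `ℝ^(|A||B||X||Y|)`. -/
abbrev Stats (A B X Y : Type) : Type := A → B → X → Y → ℝ

/-- A quantum Bell scenario `(N, M, ρ)`: `N a x` is the effect `N_{a|x}` of the first party,
`M b y` is the effect `M_{b|y}` of the second party, and `ρ` is a bipartite density matrix. -/
structure BellScenario (A B X Y dA dB : Type) [Fintype A] [Fintype B]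
    [Fintype dA] [Fintype dB] [DecidableEq dA] [DecidableEq dB] where
  N : A → X → Matrix dA dA ℂ
  N_pos : ∀ a x, (N a x).PosSemidef
  N_complete : ∀ x, ∑ a, N a x = 1
  M : B → Y → Matrix dB dB ℂ
  M_pos : ∀ b y, (M b y).PosSemidef
  M_complete : ∀ y, ∑ b, M b y = 1
  ρ : Matrix (dA × dB) (dA × dB) ℂ
  ρ_pos : ρ.PosSemidef
  ρ_trace : ρ.trace = 1

/-- All operational identities `∑ α_{a,x} E_{a|x} = 0` of an indexed family of operators. -/
def allIdentities {A X d : Type} [Fintype A] [Fintype X] (E : A → X → Matrix d d ℂ) :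
    Set (A → X → ℝ) :=
  {α | ∑ a, ∑ x, α a x • E a x = 0}

/-- The trivial identities: those that arise (as linear combinations) from
`∑ a, E_{a|x} = ∑ a, E_{a|x'}`. -/
def trivialIdentities (A X : Type) [DecidableEq X] : Set (A → X → ℝ) :=
  (Submodule.span ℝ
    {α : A → X → ℝ | ∃ x x' : X, α = fun _ => Pi.single x 1 - Pi.single x' 1} :
      Submodule ℝ (A → X → ℝ))

/-- The letters `a` (all) and `t` (trivial). -/
inductive Letter where
  | a
  | t

/-- The set of identities selected by a letter. -/
def selectedIdentities {A X d : Type} [Fintype A] [Fintype X] [DecidableEq X]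
    (E : A → X → Matrix d d ℂ) : Letter → Set (A → X → ℝ)
  | .a => allIdentities E
  | .t => trivialIdentities A X

/-- A coefficient vector together with the family (`N`, `M`, `N ∘ ρ` or `M ∘ ρ`) whose operational
identity it is. -/
inductive OpIdentity (A B X Y : Type) where
  | onN (α : A → X → ℝ)
  | onM (β : B → Y → ℝ)
  | onNρ (α : A → X → ℝ)
  | onMρ (β : B → Y → ℝ)

section Scenario

variable {A B X Y dA dB : Type} [Fintype A] [Fintype B] [Fintype X] [Fintype Y]
  [DecidableEq X] [DecidableEq Y] [Fintype dA] [Fintype dB] [DecidableEq dA] [DecidableEq dB]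

/-- The partial trace over the first factor. -/
def partialTraceA (R : Matrix (dA × dB) (dA × dB) ℂ) : Matrix dB dB ℂ :=
  Matrix.of fun i j => ∑ k, R (k, i) (k, j)

/-- The partial trace over the second factor. -/
def partialTraceB (R : Matrix (dA × dB) (dA × dB) ℂ) : Matrix dA dA ℂ :=
  Matrix.of fun i j => ∑ k, R (i, k) (j, k)

/-- The steering assemblage `N ∘ ρ` on the second party. -/
def BellScenario.steerB (S : BellScenario A B X Y dA dB) (a : A) (x : X) : Matrix dB dB ℂ :=
  partialTraceA ((S.N a x ⊗ₖ (1 : Matrix dB dB ℂ)) * S.ρ)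

/-- The steering assemblage `M ∘ ρ` on the first party. -/
def BellScenario.steerA (S : BellScenario A B X Y dA dB) (b : B) (y : Y) : Matrix dA dA ℂ :=
  partialTraceB (((1 : Matrix dA dA ℂ) ⊗ₖ S.M b y) * S.ρ)

/-- The set `O_{ijuv}` of operational identities. -/
def BellScenario.O (S : BellScenario A B X Y dA dB) (i j u v : Letter) :
    Set (OpIdentity A B X Y) :=
  OpIdentity.onN '' selectedIdentities S.N i ∪ OpIdentity.onM '' selectedIdentities S.M j ∪
    OpIdentity.onNρ '' selectedIdentities S.steerB u ∪
    OpIdentity.onMρ '' selectedIdentities S.steerA v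

/-- The quantum statistics `p(ab|xy) = Tr[ρ (N_{a|x} ⊗ M_{b|y})]`. -/
noncomputable def BellScenario.stats (S : BellScenario A B X Y dA dB) : Stats A B X Y :=
  fun a b x y => (S.ρ * (S.N a x ⊗ₖ S.M b y)).trace.re

end Scenario

/-! ### Ontological models and the sets of realizable statistics -/

/-- A diagram-preserving (local) ontological model with finite ontic state spaces `Fin m`, `Fin n`:
a joint distribution `μ` and response functions `ξA a x l = p(a|x,l)`, `ξB b y l = p(b|y,l)`. -/
structure OntologicalModel (A B X Y : Type) [Fintype A] [Fintype B] (m n : ℕ) where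
  μ : Fin m → Fin n → ℝ
  μ_nonneg : ∀ k l, 0 ≤ μ k l
  μ_sum : ∑ k, ∑ l, μ k l = 1
  ξA : A → X → Fin m → ℝ
  ξA_nonneg : ∀ a x k, 0 ≤ ξA a x k
  ξA_sum : ∀ x k, ∑ a, ξA a x k = 1
  ξB : B → Y → Fin n → ℝ
  ξB_nonneg : ∀ b y l, 0 ≤ ξB b y l
  ξB_sum : ∀ y l, ∑ b, ξB b y l = 1

section Models

variable {A B X Y : Type} [Fintype A] [Fintype B] [Fintype X] [Fintype Y]

/-- The statistics reproduced by a model. -/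
def OntologicalModel.stats {m n : ℕ} (Λ : OntologicalModel A B X Y m n) : Stats A B X Y :=
  fun a b x y => ∑ k, ∑ l, Λ.μ k l * Λ.ξA a x k * Λ.ξB b y l

/-- The ontological identity that noncontextuality attaches to an operational identity. -/
def OntologicalModel.Respects {m n : ℕ} (Λ : OntologicalModel A B X Y m n) :
    OpIdentity A B X Y → Prop
  | .onN α => ∀ k, ∑ a, ∑ x, α a x * Λ.ξA a x k = 0
  | .onM β => ∀ l, ∑ b, ∑ y, β b y * Λ.ξB b y l = 0
  | .onNρ α => ∀ l, ∑ a, ∑ x, α a x * ∑ k, Λ.ξA a x k * Λ.μ k l = 0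
  | .onMρ β => ∀ k, ∑ b, ∑ y, β b y * ∑ l, Λ.ξB b y l * Λ.μ k l = 0

/-- The statistics that are NCOM-realizable relative to a set of operational identities. -/
def realizable (I : Set (OpIdentity A B X Y)) : Set (Stats A B X Y) :=
  {p | ∃ (m n : ℕ) (Λ : OntologicalModel A B X Y m n), (∀ o ∈ I, Λ.Respects o) ∧ Λ.stats = p}

/-- The set `NC_{ijuv}` of statistics that are NCOM-realizable relative to `O_{ijuv}`. -/
def BellScenario.NC {dA dB : Type} [Fintype dA] [Fintype dB] [DecidableEq dA] [DecidableEq dB]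
    [DecidableEq X] [DecidableEq Y] (S : BellScenario A B X Y dA dB) (i j u v : Letter) :
    Set (Stats A B X Y) :=
  realizable (S.O i j u v)

end Models

/-! ### Facets and symmetry classes -/

/-- The dimension of (the affine span of) a set. -/
noncomputable def affDim {E : Type} [AddCommGroup E] [Module ℝ E] (P : Set E) : ℕ :=
  Module.finrank ℝ (affineSpan ℝ P).direction

/-- `F` is a facet of the polytope `P`: a nonempty exposed face of codimension one. -/
def IsFacet {E : Type} [AddCommGroup E] [Module ℝ E] [TopologicalSpace E] (P F : Set E) : Prop :=
  F.Nonempty ∧ IsExposed ℝ P F ∧ affDim F + 1 = affDim P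

/-- The facets that are not given by a nonnegativity constraint `p(ab|xy) ≥ 0`. -/
def nontrivialFacets {A B X Y : Type} (P : Set (Stats A B X Y)) : Set (Set (Stats A B X Y)) :=
  {F | IsFacet P F ∧ ∀ a b x y, F ≠ {p ∈ P | p a b x y = 0}}

/-- A permutation of the settings, together with a permutation of the outcomes for each setting. -/
structure Relabeling (A X : Type) where
  setting : Equiv.Perm X
  outcome : X → Equiv.Perm A

/-- A relabeling is a symmetry of a family of effects if it preserves the set of all operational
identities of that family. -/
def Relabeling.IsSymmetry {A X d : Type} [Fintype A] [Fintype X] (g : Relabeling A X)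
    (E : A → X → Matrix d d ℂ) : Prop :=
  ∀ α : A → X → ℝ,
    (fun a x => α (g.outcome x a) (g.setting x)) ∈ allIdentities E ↔ α ∈ allIdentities E

/-- The action of relabelings of both parties on statistics. -/
def relabel {A B X Y : Type} (g : Relabeling A X) (h : Relabeling B Y) (p : Stats A B X Y) :
    Stats A B X Y :=
  fun a b x y => p (g.outcome x a) (h.outcome y b) (g.setting x) (h.setting y)

/-- The class of a face `F`: its orbit under those relabelings of settings and outcomes that are
symmetries of the two parties' operational identities. -/
def BellScenario.faceClass {A B X Y dA dB : Type} [Fintype A] [Fintype B] [Fintype X] [Fintype Y]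
    [Fintype dA] [Fintype dB] [DecidableEq dA] [DecidableEq dB] (S : BellScenario A B X Y dA dB)
    (F : Set (Stats A B X Y)) : Set (Set (Stats A B X Y)) :=
  {F' | ∃ (g : Relabeling A X) (h : Relabeling B Y),
    g.IsSymmetry S.N ∧ h.IsSymmetry S.M ∧ F' = relabel g h ⁻¹' F}

/-! ### The octahedron and the cube -/

/-- The affine identities `∑ α_{a,x} = 0`, `∑ α_{a,x} t_{a,x} = 0` among the labelled vertices of
a polyhedron. The first equation makes the set independent of the choice of coordinates; for
effects it is forced by taking traces when all effects have the same nonzero trace. -/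
def vertexIdentities {A X : Type} [Fintype A] [Fintype X] (t : A → X → Fin 3 → ℝ) :
    Set (A → X → ℝ) :=
  {α | ∑ a, ∑ x, α a x = 0 ∧ ∑ a, ∑ x, α a x • t a x = 0}

/-- The intrinsic geometry of a family of effects is that of the polyhedron with vertices `t`. -/
def HasShape {A X d : Type} [Fintype A] [Fintype X] (E : A → X → Matrix d d ℂ)
    (t : A → X → Fin 3 → ℝ) : Prop :=
  allIdentities E = vertexIdentities t

/-- Three directions through the vertices of a regular octahedron. -/
def octahedronAxis : Fin 3 → Fin 3 → ℝ := ![![1, 0, 0], ![0, 1, 0], ![0, 0, 1]]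

/-- Four directions through the vertices of a cube. -/
def cubeAxis : Fin 4 → Fin 3 → ℝ := ![![1, 1, 1], ![1, 1, -1], ![1, -1, 1], ![1, -1, -1]]

/-- The vertices `(-1)^a m_x`; the outcomes of one setting are antipodal vertices. -/
def antipodal {X : Type} (m : X → Fin 3 → ℝ) (a : Fin 2) (x : X) : Fin 3 → ℝ :=
  (-1 : ℝ) ^ (a : ℕ) • m x

/-! ### The three inequalities -/

/-- `p(01|22) + p(10|03) - p(11|00) + p(11|21)` -/
def ineq₁ (p : Stats (Fin 2) (Fin 2) (Fin 3) (Fin 4)) : ℝ :=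
  p 0 1 2 2 + p 1 0 0 3 - p 1 1 0 0 + p 1 1 2 1

/-- `p(01|22) + p(10|03) - p(11|00) + p(11|20)` -/
def ineq₂ (p : Stats (Fin 2) (Fin 2) (Fin 3) (Fin 4)) : ℝ :=
  p 0 1 2 2 + p 1 0 0 3 - p 1 1 0 0 + p 1 1 2 0

/-- `p(01|22) + p(10|03) - p(11|00) + p(11|10) - p(11|12) - p(11|20) + p(11|21) + p(11|22)` -/
def ineq₃ (p : Stats (Fin 2) (Fin 2) (Fin 3) (Fin 4)) : ℝ :=
  p 0 1 2 2 + p 1 0 0 3 - p 1 1 0 0 + p 1 1 1 0 - p 1 1 1 2 - p 1 1 2 0 + p 1 1 2 1 + p 1 1 2 2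

/-! ### The qubit realization with isotropic states -/

/-- `v · σ` for the vector `σ` of Pauli matrices. -/
noncomputable def pauliDot (v : Fin 3 → ℝ) : Matrix (Fin 2) (Fin 2) ℂ :=
  v 0 • !![0, 1; 1, 0] + v 1 • !![0, -Complex.I; Complex.I, 0] + v 2 • !![1, 0; 0, -1]

/-- The projective measurements `½ (1 + (-1)^a m_x · σ)`. -/
noncomputable def qubitEffect {X : Type} (m : X → Fin 3 → ℝ) (a : Fin 2) (x : X) :
    Matrix (Fin 2) (Fin 2) ℂ :=
  (1 / 2 : ℝ) • (1 + (-1 : ℝ) ^ (a : ℕ) • pauliDot (m x))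

/-- The vector `|Φ⁺⟩ = (|00⟩ + |11⟩)/√2`. -/
noncomputable def phiPlus : Fin 2 × Fin 2 → ℂ :=
  fun ij => if ij.1 = ij.2 then ((1 / Real.sqrt 2 : ℝ) : ℂ) else 0

/-- The isotropic state `p |Φ⁺⟩⟨Φ⁺| + (1 - p) 1/4`. -/
noncomputable def isotropic (p : ℝ) : Matrix (Fin 2 × Fin 2) (Fin 2 × Fin 2) ℂ :=
  p • Matrix.vecMulVec phiPlus (star phiPlus) + ((1 - p) / 4) • 1

theorem qubitEffect_posSemidef {X : Type} (m : X → Fin 3 → ℝ)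
    (hm : ∀ x, m x 0 ^ 2 + m x 1 ^ 2 + m x 2 ^ 2 = 1) (a : Fin 2) (x : X) :
    (qubitEffect m a x).PosSemidef := by
  have key : qubitEffect m a x = (qubitEffect m a x)ᴴ * qubitEffect m a x := by
    have h : ((m x 0 : ℂ)) ^ 2 + (m x 1 : ℂ) ^ 2 + (m x 2 : ℂ) ^ 2 = 1 := by
      exact_mod_cast hm x
    have hI : Complex.I ^ 2 = -1 := Complex.I_sq
    have hc : (starRingEnd ℂ) 2 = 2 := map_ofNat _ 2
    ext i j
    fin_cases a <;> fin_cases i <;> fin_cases j <;>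
      simp [qubitEffect, pauliDot, Matrix.mul_apply, Fin.sum_univ_two] <;>
      grind
  rw [key]
  exact Matrix.posSemidef_conjTranspose_mul_self _

theorem qubitEffect_sum {X : Type} (m : X → Fin 3 → ℝ) (x : X) :
    ∑ a, qubitEffect m a x = 1 := by
  simp only [Fin.sum_univ_two, qubitEffect, ← smul_add]
  ext i j
  simp
  ring

theorem isotropic_posSemidef {p : ℝ} (hp : p ∈ Set.Icc (0 : ℝ) 1) :
    (isotropic p).PosSemidef := by
  unfold isotropic
  have h1 := (Matrix.posSemidef_vecMulVec_self_star phiPlus).smul hp.1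
  have h2 := (Matrix.PosSemidef.one (n := Fin 2 × Fin 2) (R := ℂ)).smul
    (show 0 ≤ (1 - p) / 4 by linarith [hp.2])
  exact h1.add h2

theorem isotropic_trace (p : ℝ) : (isotropic p).trace = 1 := by
  have h : (((Real.sqrt 2 : ℝ) : ℂ))⁻¹ * ((Real.sqrt 2 : ℝ) : ℂ)⁻¹ = 1 / 2 := by
    rw [← mul_inv, ← Complex.ofReal_mul, Real.mul_self_sqrt (by norm_num)]
    norm_num
  simp [isotropic, Matrix.trace, Fintype.sum_prod_type, Fin.sum_univ_two, Matrix.vecMulVec_apply,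
    phiPlus]
  linear_combination (2 * (p : ℂ)) * h

/-- The isotropic state measured along the axes of an octahedron and of a cube. -/
noncomputable def octCubeScenario (p : ℝ) (hp : p ∈ Set.Icc (0 : ℝ) 1) :
    BellScenario (Fin 2) (Fin 2) (Fin 3) (Fin 4) (Fin 2) (Fin 2) where
  N := qubitEffect octahedronAxis
  N_pos := qubitEffect_posSemidef _ (by intro x; fin_cases x <;> simp [octahedronAxis])
  N_complete := qubitEffect_sum _
  M := qubitEffect fun y => (1 / Real.sqrt 3) • cubeAxis y
  M_pos := qubitEffect_posSemidef _ (by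
    intro x; fin_cases x <;> simp [cubeAxis] <;> norm_num)
  M_complete := qubitEffect_sum _
  ρ := isotropic p
  ρ_pos := isotropic_posSemidef hp
  ρ_trace := isotropic_trace p

end NCBell

open NCBell

/-! The octahedron has only trivial affine dependencies, so the first party's responses are
arbitrary: a 3-cube whose vertices are the 8 outcome assignments `u`. The cube has one further
dependency, `rectangleIdentity`. Imposing it leaves functions `f · cubeAxis y` bounded by 1 on the
four diagonals, i.e. an ℓ¹ ball: an octahedron with 6 vertices `cubeOutcome (i, s)`. Trivial
conditions on the assemblages follow from normalisation. Hence the noncontextual set is the hull of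
48 products (`BellScenario.NC_eq_octCubePolytope`). The inclusions are strict because a
deterministic assignment can violate the rectangle identity.

At the vertex `(u, i, s)`, with bits read as signs, a functional takes the value `t + s a_i + ∑ u_j
(w_j + s b_ij)` (`apply_vertex`). Its 16 coefficients are free, which gives dimension 15. Let it be
nonnegative and consider its zeros. If some `w_j ≠ 0`, minimality in `u_j` excludes one value of
`u_j` at a suitable sign `s_i` for each `i`; the signs `s_i` form a cube vertex, so some `p(ab|xy)`
vanishes at all zeros. If `w = 0`, then for each `i` a zero forces `s` to be a literal in `u`: a
constant or a possibly flipped `u_j`. So every proper face lies in a nonnegativity face or in the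
zero set of some `facetForm τ` (`exists_zero_superset`). That zero set is a nontrivial facet if `τ`
uses at least two axes (`isFacet_facetOf`, `facetOf_ne_trivial`), and lies in a nonnegativity face
otherwise.

Facets are thus labelled by triples of literals. Symmetries permute the three positions and the
three axes, and flip each literal independently, so an orbit is an axis pattern up to permutation
(`BellScenario.faceClass_facetOf`). Three patterns remain, with 18·8, 18·8 and 6·8 labels. -/

namespace NCBell

/-! ### Facets of polytopes inside an affine hyperplane -/

section Facets

variable {E : Type} [AddCommGroup E] [Module ℝ E] [FiniteDimensional ℝ E]

/-- Homogenisation: on the hyperplane `N = 1` the direction of the affine span is the kernel of `N`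
in the linear span, so affine dimensions become ranks of linear spans. -/
theorem affDim_add_one {F : Set E} (hF : F.Nonempty) (N : E →ₗ[ℝ] ℝ) (hN : ∀ x ∈ F, N x = 1) :
    affDim F + 1 = Module.finrank ℝ (Submodule.span ℝ F) := by
  obtain ⟨p, hp⟩ := hF
  set L := Submodule.span ℝ F with hL
  set f : L →ₗ[ℝ] ℝ := N ∘ₗ L.subtype with hf
  have hpL : p ∈ L := Submodule.subset_span hp
  have hsurj : LinearMap.range f = ⊤ := by
    rw [LinearMap.range_eq_top]
    intro r
    exact ⟨r • ⟨p, hpL⟩, by simp [hf, hN p hp]⟩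
  have hker : (LinearMap.ker f).map L.subtype = vectorSpan ℝ F := by
    apply le_antisymm
    · rintro _ ⟨⟨x, hx⟩, hx0, rfl⟩
      have key : ∀ y ∈ L, y - N y • p ∈ vectorSpan ℝ F := by
        intro y hy
        induction hy using Submodule.span_induction with
        | mem y hy =>
          rw [hN y hy, one_smul]
          exact vsub_mem_vectorSpan ℝ hy hp
        | zero => simp
        | add y z _ _ hy hz =>
          have := add_mem hy hz
          rw [map_add, add_smul]
          convert this using 1
          abel
        | smul r y _ hy =>
          have := Submodule.smul_mem _ r hy
          rw [map_smul, smul_eq_mul, mul_smul, ← smul_sub]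
          exact this
      have h0 : N x = 0 := hx0
      simpa [h0] using key x hx
    · rw [vectorSpan_def, Submodule.span_le]
      rintro _ ⟨x, hx, y, hy, rfl⟩
      refine ⟨⟨x - y, sub_mem (Submodule.subset_span hx) (Submodule.subset_span hy)⟩, ?_, rfl⟩
      simp [hf, hN x hx, hN y hy]
  have h1 := f.finrank_range_add_finrank_ker
  rw [hsurj, finrank_top, Module.finrank_self] at h1
  have h2 : Module.finrank ℝ (LinearMap.ker f) = affDim F := by
    rw [affDim, direction_affineSpan, ← hker]
    exact (LinearEquiv.finrank_eq (Submodule.equivMapOfInjective L.subtype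
      L.injective_subtype (LinearMap.ker f)))
  omega

theorem finrank_inf_ker {L : Submodule ℝ E} {φ : E →ₗ[ℝ] ℝ} {x : E} (hx : x ∈ L) (h : φ x ≠ 0) :
    Module.finrank ℝ (L ⊓ LinearMap.ker φ : Submodule ℝ E) + 1 = Module.finrank ℝ L := by
  set f : L →ₗ[ℝ] ℝ := φ ∘ₗ L.subtype with hf
  have hsurj : LinearMap.range f = ⊤ := by
    rw [LinearMap.range_eq_top]
    intro r
    refine ⟨(r / φ x) • ⟨x, hx⟩, ?_⟩
    simp [hf, h]
  have hker : (LinearMap.ker f).map L.subtype = L ⊓ LinearMap.ker φ := by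
    ext y
    simp [hf, and_comm]
  have h1 := f.finrank_range_add_finrank_ker
  rw [hsurj, finrank_top, Module.finrank_self] at h1
  rw [← hker, ← LinearEquiv.finrank_eq (Submodule.equivMapOfInjective L.subtype
      L.injective_subtype (LinearMap.ker f))]
  omega

variable [TopologicalSpace E]

/-- No sign of `φ` is needed: `span F` has codimension one in `span P` and lies in `ker φ`, so it is
all of `span P ⊓ ker φ`. The functional exposing `F` then attains its maximum at every zero of `φ`
in `P`. -/
theorem IsFacet.eq_of_subset {P F : Set E} (hF : IsFacet P F) (N : E →ₗ[ℝ] ℝ)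
    (hN : ∀ x ∈ P, N x = 1) {φ : E →ₗ[ℝ] ℝ} (hφ : ∃ x ∈ P, φ x ≠ 0) (h : ∀ x ∈ F, φ x = 0) :
    F = {x ∈ P | φ x = 0} := by
  obtain ⟨hne, hexp, hdim⟩ := hF
  have hFP : F ⊆ P := hexp.subset
  obtain ⟨l, hl⟩ := hexp hne
  obtain ⟨x₀, hx₀P, hx₀⟩ := hφ
  obtain ⟨p, hp⟩ := hne
  have h1 := affDim_add_one ⟨p, hp⟩ N fun x hx => hN x (hFP hx)
  have h2 := affDim_add_one ⟨p, hFP hp⟩ N hN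
  have h3 := finrank_inf_ker (Submodule.subset_span (R := ℝ) hx₀P) hx₀
  have hle : Submodule.span ℝ F ≤ Submodule.span ℝ P ⊓ LinearMap.ker φ :=
    le_inf (Submodule.span_mono hFP) (Submodule.span_le.2 h)
  have heq := Submodule.eq_of_le_of_finrank_le hle (by omega)
  refine Set.Subset.antisymm (fun x hx => ⟨hFP hx, h x hx⟩) ?_
  rintro x ⟨hxP, hx⟩
  have hxF : x ∈ Submodule.span ℝ F := by
    rw [heq]
    exact ⟨Submodule.subset_span hxP, hx⟩
  -- Subtracting a multiple of `N` turns "constant on `F`" into "zero on `span F`".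
  set g : E →ₗ[ℝ] ℝ := (l : E →ₗ[ℝ] ℝ) - l p • N with hg
  have hgF : ∀ y ∈ F, g y = 0 := by
    intro y hy
    have e : l y = l p := by
      have hy' := hy
      have hp' := hp
      rw [hl] at hy' hp'
      exact le_antisymm (hp'.2 y hy'.1) (hy'.2 p hp'.1)
    simp [hg, hN y (hFP hy), e]
  have hgx : g x = 0 := (Submodule.span_le (p := LinearMap.ker g)).2 hgF hxF
  have hlx : l x = l p := by
    simp [hg, hN x hxP] at hgx
    linarith
  rw [hl] at hp ⊢
  exact ⟨hxP, fun y hy => hlx ▸ hp.2 y hy⟩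

/-- The dimension comes from duality: a vector of `span P ⊓ ker φ` outside the span of the face
would be detected by some `ψ` vanishing on the face, but such a `ψ` is proportional to `φ`. -/
theorem isFacet_of_unique [IsTopologicalAddGroup E] [ContinuousSMul ℝ E] [T2Space E]
    {P : Set E} (N : E →ₗ[ℝ] ℝ)
    (hN : ∀ x ∈ P, N x = 1) {φ : E →ₗ[ℝ] ℝ} (hpos : ∀ x ∈ P, 0 ≤ φ x) (hφ : ∃ x ∈ P, φ x ≠ 0)
    (hne : ∃ x ∈ P, φ x = 0)
    (huniq : ∀ ψ : E →ₗ[ℝ] ℝ, (∀ x ∈ P, φ x = 0 → ψ x = 0) → ∃ c : ℝ, ∀ x ∈ P, ψ x = c * φ x) :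
    IsFacet P {x ∈ P | φ x = 0} := by
  obtain ⟨x₀, hx₀P, hx₀⟩ := hφ
  obtain ⟨p, hpP, hp⟩ := hne
  refine ⟨⟨p, hpP, hp⟩, fun _ => ⟨LinearMap.toContinuousLinearMap (-φ), ?_⟩, ?_⟩
  · ext x
    constructor
    · rintro ⟨hx, h0⟩
      exact ⟨hx, fun y hy => by simpa [h0] using hpos y hy⟩
    · rintro ⟨hx, h0⟩
      have := h0 p hpP
      simp [hp] at this
      exact ⟨hx, le_antisymm this (hpos x hx)⟩
  · have h1 := affDim_add_one (F := {x ∈ P | φ x = 0}) ⟨p, hpP, hp⟩ N fun x hx => hN x hx.1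
    have h2 := affDim_add_one ⟨p, hpP⟩ N hN
    have h3 := finrank_inf_ker (Submodule.subset_span (R := ℝ) hx₀P) hx₀
    have heq : Submodule.span ℝ {x ∈ P | φ x = 0} = Submodule.span ℝ P ⊓ LinearMap.ker φ := by
      apply le_antisymm
      · exact le_inf (Submodule.span_mono fun x hx => hx.1) (Submodule.span_le.2 fun x hx => hx.2)
      · rintro x ⟨hxP, hx⟩
        by_contra hnot
        obtain ⟨ψ, hψx, hψ⟩ := Submodule.exists_dual_map_eq_bot_of_notMem hnot inferInstance
        obtain ⟨c, hc⟩ := huniq ψ fun y hy hy0 => by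
          have : ψ y ∈ (Submodule.span ℝ {x ∈ P | φ x = 0}).map ψ :=
            Submodule.mem_map_of_mem (Submodule.subset_span ⟨hy, hy0⟩)
          rw [hψ] at this
          simpa using this
        have hle : Submodule.span ℝ P ≤ LinearMap.ker (ψ - c • φ) := by
          rw [Submodule.span_le]
          intro y hy
          simp [hc y hy]
        have h4 : ψ x - c * φ x = 0 := by simpa using hle hxP
        have hx' : φ x = 0 := hx
        rw [hx', mul_zero, sub_zero] at h4
        exact hψx h4
    rw [heq] at h1
    omega

end Facets

/-- If nonnegative terms sum to zero, each is zero. With `φ = 0` this carries the vanishing of `ψ`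
from the generators to the hull. -/
theorem convexHull_zero_imp_zero {E : Type} [AddCommGroup E] [Module ℝ E] {V : Set E}
    {φ ψ : E →ₗ[ℝ] ℝ}
    (hpos : ∀ x ∈ V, 0 ≤ φ x) (h : ∀ x ∈ V, φ x = 0 → ψ x = 0) :
    ∀ x ∈ convexHull ℝ V, 0 ≤ φ x ∧ (φ x = 0 → ψ x = 0) := by
  have hconv : Convex ℝ {x | 0 ≤ φ x ∧ (φ x = 0 → ψ x = 0)} := by
    rintro x ⟨hx, hx0⟩ y ⟨hy, hy0⟩ a b ha hb _
    have hax := mul_nonneg ha hx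
    have hby := mul_nonneg hb hy
    refine ⟨by simp only [map_add, map_smul, smul_eq_mul]; positivity, fun h0 => ?_⟩
    simp only [map_add, map_smul, smul_eq_mul] at h0 ⊢
    have h1 : a * φ x = 0 := by linarith
    have h2 : b * φ y = 0 := by linarith
    have h3 : a * ψ x = 0 := by
      rcases mul_eq_zero.1 h1 with h | h
      · simp [h]
      · simp [hx0 h]
    have h4 : b * ψ y = 0 := by
      rcases mul_eq_zero.1 h2 with h | h
      · simp [h]
      · simp [hy0 h]
    linarith
  have hsub : V ⊆ {x | 0 ≤ φ x ∧ (φ x = 0 → ψ x = 0)} := fun x hx => ⟨hpos x hx, h x hx⟩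
  exact fun x hx => convexHull_min hsub hconv hx

/-! ### Deterministic strategies and product points -/

/-- The sign `(-1)^s`. -/
noncomputable def sgn (s : Fin 2) : ℝ := (-1) ^ (s : ℕ)

@[simp] theorem sgn_zero : sgn 0 = 1 := by simp [sgn]

@[simp] theorem sgn_one : sgn 1 = -1 := by simp [sgn]

theorem sgn_add (s t : Fin 2) : sgn (s + t) = sgn s * sgn t := by
  fin_cases s <;> fin_cases t <;> simp

theorem sgn_mul_self (s : Fin 2) : sgn s * sgn s = 1 := by
  fin_cases s <;> simp

theorem ite_eq_sgn (s t : Fin 2) : (if s = t then (1 : ℝ) else 0) = (1 + sgn s * sgn t) / 2 := by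
  fin_cases s <;> fin_cases t <;> simp

theorem exists_sgn_mul_pos {r : ℝ} (hr : r ≠ 0) : ∃ s, 0 < sgn s * r := by
  rcases lt_or_gt_of_ne hr with h | h
  · exact ⟨1, by simpa using h⟩
  · exact ⟨0, by simpa using h⟩

theorem eq_of_sgn_mul_nonpos {s t : Fin 2} {r : ℝ} (hs : 0 < sgn s * r) (ht : sgn t * r ≤ 0) :
    t = s + 1 := by
  fin_cases s <;> fin_cases t <;> simp at hs ht ⊢ <;> linarith

theorem three_cases (i : Fin 3) : i = 0 ∨ i = 1 ∨ i = 2 := by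
  revert i; decide

theorem eq_add_one_of_ne {s t : Fin 2} (h : s ≠ t) : s = t + 1 := by
  revert s t; decide

/-- The product statistics of two families of local probabilities. -/
def tens {A B X Y : Type} : (A → X → ℝ) →ₗ[ℝ] (B → Y → ℝ) →ₗ[ℝ] Stats A B X Y :=
  LinearMap.mk₂ ℝ (fun α β a b x y => α a x * β b y)
    (fun _ _ _ => by funext a b x y; simp [add_mul])
    (fun _ _ _ => by funext a b x y; simp [mul_assoc])
    (fun _ _ _ => by funext a b x y; simp [mul_add])
    (fun _ _ _ => by funext a b x y; simp [mul_left_comm])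

@[simp] theorem tens_apply {A B X Y : Type} (α : A → X → ℝ) (β : B → Y → ℝ) (a : A) (b : B)
    (x : X) (y : Y) : tens α β a b x y = α a x * β b y := rfl

/-- The deterministic response function of an assignment of outcomes to settings. -/
def response {A X : Type} [DecidableEq A] (u : X → A) (a : A) (x : X) : ℝ :=
  if u x = a then 1 else 0

/-- The sign of a coordinate of a vertex of the cube, as a bit. -/
def cubeBit : Fin 4 → Fin 3 → Fin 2 := ![![0, 0, 0], ![0, 0, 1], ![0, 1, 0], ![0, 1, 1]]

theorem cubeAxis_eq (y : Fin 4) (i : Fin 3) : cubeAxis y i = sgn (cubeBit y i) := by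
  fin_cases y <;> fin_cases i <;> simp [cubeAxis, cubeBit]

theorem cubeAxis_table :
    (cubeAxis 0 0 = 1 ∧ cubeAxis 0 1 = 1 ∧ cubeAxis 0 2 = 1) ∧
    (cubeAxis 1 0 = 1 ∧ cubeAxis 1 1 = 1 ∧ cubeAxis 1 2 = -1) ∧
    (cubeAxis 2 0 = 1 ∧ cubeAxis 2 1 = -1 ∧ cubeAxis 2 2 = 1) ∧
    (cubeAxis 3 0 = 1 ∧ cubeAxis 3 1 = -1 ∧ cubeAxis 3 2 = -1) := by
  simp [cubeAxis]

/-- The six outcome assignments that respect the identities of the cube, labelled by the vertices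
of the dual octahedron. -/
def cubeOutcome (v : Fin 3 × Fin 2) (y : Fin 4) : Fin 2 := v.2 + cubeBit y v.1

/-- The product of a deterministic response for the octahedron and one for the cube. -/
def vertex (w : (Fin 3 → Fin 2) × (Fin 3 × Fin 2)) : Stats (Fin 2) (Fin 2) (Fin 3) (Fin 4) :=
  tens (response w.1) (response (cubeOutcome w.2))

theorem vertex_apply (w : (Fin 3 → Fin 2) × (Fin 3 × Fin 2)) (a b : Fin 2) (x : Fin 3)
    (y : Fin 4) : vertex w a b x y = if w.1 x = a ∧ cubeOutcome w.2 y = b then 1 else 0 := by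
  by_cases h1 : w.1 x = a <;> by_cases h2 : cubeOutcome w.2 y = b <;>
    simp [vertex, response, h1, h2]

/-- The polytope of the product strategies. -/
def octCubePolytope : Set (Stats (Fin 2) (Fin 2) (Fin 3) (Fin 4)) :=
  convexHull ℝ (Set.range vertex)

/-- A basis of the span of the response functions of the octahedron. -/
noncomputable def octBase : Option (Fin 3) → Fin 2 → Fin 3 → ℝ
  | none => fun _ _ => 1 / 2
  | some j => fun a x => if x = j then sgn a / 2 else 0

/-- A basis of the span of the response functions that respect the identities of the cube. -/
noncomputable def cubeBase : Option (Fin 3) → Fin 2 → Fin 4 → ℝ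
  | none => fun _ _ => 1 / 2
  | some i => fun b y => sgn b * cubeAxis y i / 2

theorem response_octahedron (u : Fin 3 → Fin 2) :
    response u = octBase none + ∑ j, sgn (u j) • octBase (some j) := by
  funext a x
  simp only [response, octBase, Pi.add_apply, Finset.sum_apply, Pi.smul_apply, smul_eq_mul,
    mul_ite, mul_zero, Finset.sum_ite_eq, Finset.mem_univ, if_true, ite_eq_sgn]
  ring

theorem response_cube (v : Fin 3 × Fin 2) :
    response (cubeOutcome v) = cubeBase none + sgn v.2 • cubeBase (some v.1) := by
  funext b y
  simp only [response, cubeBase, Pi.add_apply, Pi.smul_apply, smul_eq_mul, ite_eq_sgn, cubeAxis_eq]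
  simp only [cubeOutcome, sgn_add]
  ring

/-- By bilinearity, for fixed `(i, s)` the value is affine in the signs of `u`. The arguments about
facets use only these coefficients. -/
theorem apply_vertex (l : Stats (Fin 2) (Fin 2) (Fin 3) (Fin 4) →ₗ[ℝ] ℝ) (u : Fin 3 → Fin 2)
    (i : Fin 3) (s : Fin 2) :
    l (vertex (u, i, s)) = (l (tens (octBase none) (cubeBase none)) +
        sgn s * l (tens (octBase none) (cubeBase (some i)))) +
      ∑ j, sgn (u j) * (l (tens (octBase (some j)) (cubeBase none)) +
        sgn s * l (tens (octBase (some j)) (cubeBase (some i)))) := by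
  simp only [vertex, response_octahedron, response_cube, map_add, map_smul, map_sum,
    LinearMap.add_apply, LinearMap.smul_apply, LinearMap.sum_apply, Finset.sum_add_distrib,
    smul_eq_mul, mul_add, Finset.mul_sum, mul_left_comm]
  ring

/-! ### Linear functionals -/

/-- The linear functional on statistics with product coefficients. -/
def pairing {A B X Y : Type} [Fintype A] [Fintype B] [Fintype X] [Fintype Y]
    (α : A → X → ℝ) (β : B → Y → ℝ) : Stats A B X Y →ₗ[ℝ] ℝ where
  toFun p := ∑ a, ∑ x, ∑ b, ∑ y, α a x * β b y * p a b x y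
  map_add' p q := by
    simp only [Pi.add_apply, mul_add, Finset.sum_add_distrib]
  map_smul' r p := by
    simp only [Pi.smul_apply, smul_eq_mul, Finset.mul_sum, RingHom.id_apply]
    simp only [mul_left_comm]

theorem pairing_tens {A B X Y : Type} [Fintype A] [Fintype B] [Fintype X] [Fintype Y]
    (α f : A → X → ℝ) (β g : B → Y → ℝ) :
    pairing α β (tens f g) = (∑ a, ∑ x, α a x * f a x) * ∑ b, ∑ y, β b y * g b y := by
  simp only [pairing, LinearMap.coe_mk, AddHom.coe_mk, tens_apply]
  rw [Finset.sum_mul]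
  refine Finset.sum_congr rfl fun a _ => ?_
  rw [Finset.sum_mul]
  refine Finset.sum_congr rfl fun x _ => ?_
  rw [Finset.mul_sum]
  refine Finset.sum_congr rfl fun b _ => ?_
  rw [Finset.mul_sum]
  refine Finset.sum_congr rfl fun y _ => ?_
  ring

/-- The family dual to `octBase`. -/
noncomputable def octDual : Option (Fin 3) → Fin 2 → Fin 3 → ℝ
  | none => fun _ _ => 1 / 3
  | some j => fun a x => if x = j then sgn a else 0

/-- The family dual to `cubeBase`. -/
noncomputable def cubeDual : Option (Fin 3) → Fin 2 → Fin 4 → ℝ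
  | none => fun _ _ => 1 / 4
  | some i => fun b y => sgn b * cubeAxis y i / 4

theorem octDual_octBase (o o' : Option (Fin 3)) :
    ∑ a, ∑ x, octDual o a x * octBase o' a x = if o = o' then 1 else 0 := by
  rcases o with _ | j <;> rcases o' with _ | k
  · norm_num [octDual, octBase, Fin.sum_univ_two, Fin.sum_univ_three]
  · simp [octDual, octBase, Fin.sum_univ_two]
    ring
  · simp [octDual, octBase, Fin.sum_univ_two]
  · simp [octDual, octBase, Fin.sum_univ_two, eq_comm]
    split_ifs <;> norm_num

theorem cubeDual_cubeBase (o o' : Option (Fin 3)) :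
    ∑ b, ∑ y, cubeDual o b y * cubeBase o' b y = if o = o' then 1 else 0 := by
  rcases o with _ | j <;> rcases o' with _ | k
  · norm_num [cubeDual, cubeBase, Fin.sum_univ_two, Fin.sum_univ_four]
  · rcases three_cases k with rfl | rfl | rfl <;>
      norm_num [cubeDual, cubeBase, Fin.sum_univ_two, Fin.sum_univ_four, cubeAxis_table] <;> decide
  · rcases three_cases j with rfl | rfl | rfl <;>
      norm_num [cubeDual, cubeBase, Fin.sum_univ_two, Fin.sum_univ_four, cubeAxis_table] <;> decide
  · rcases three_cases j with rfl | rfl | rfl <;> rcases three_cases k with rfl | rfl | rfl <;>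
      norm_num [cubeDual, cubeBase, Fin.sum_univ_two, Fin.sum_univ_four, cubeAxis_table] <;> decide

/-- The coordinates with respect to the products of `octBase` and `cubeBase`. -/
noncomputable def coord (o o' : Option (Fin 3)) :
    Stats (Fin 2) (Fin 2) (Fin 3) (Fin 4) →ₗ[ℝ] ℝ :=
  pairing (octDual o) (cubeDual o')

theorem coord_tens (o o' q q' : Option (Fin 3)) :
    coord o o' (tens (octBase q) (cubeBase q')) = if o = q ∧ o' = q' then 1 else 0 := by
  rw [coord, pairing_tens, octDual_octBase, cubeDual_cubeBase]
  by_cases h1 : o = q <;> by_cases h2 : o' = q' <;> simp [h1, h2]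

theorem coord_vertex (w : (Fin 3 → Fin 2) × (Fin 3 × Fin 2)) : coord none none (vertex w) = 1 := by
  obtain ⟨u, i, s⟩ := w
  simp [apply_vertex, coord_tens]

theorem coord_eq_one {p : Stats (Fin 2) (Fin 2) (Fin 3) (Fin 4)} (hp : p ∈ octCubePolytope) :
    coord none none p = 1 := by
  have hc : Convex ℝ {p | coord none none p = 1} := by
    intro x hx y hy a b _ _ hab
    change coord none none x = 1 at hx
    change coord none none y = 1 at hy
    change coord none none (a • x + b • y) = 1
    rw [map_add, map_smul, map_smul, hx, hy, smul_eq_mul, smul_eq_mul, mul_one, mul_one, hab]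
  have hsub : Set.range vertex ⊆ {p | coord none none p = 1} := by
    rintro _ ⟨w, rfl⟩
    exact coord_vertex w
  exact convexHull_min hsub hc hp

/-- Varying the two free signs separately on one face of the sign cube isolates their coefficients.
-/
theorem eq_zero_of_signs {α : ℝ} {β : Fin 3 → ℝ} (j : Fin 3) (e : Fin 2)
    (h : ∀ u : Fin 3 → Fin 2, u j = e → α + ∑ k, sgn (u k) * β k = 0) :
    α + sgn e * β j = 0 ∧ ∀ k, k ≠ j → β k = 0 := by
  have key : ∀ s t r : Fin 2, (![s, t, r] : Fin 3 → Fin 2) j = e →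
      α + sgn s * β 0 + sgn t * β 1 + sgn r * β 2 = 0 := by
    intro s t r hs
    have := h _ hs
    simp [Fin.sum_univ_three] at this
    linarith
  fin_cases j
  · have h0 := key e 0 0 rfl
    have h1 := key e 0 1 rfl
    have h2 := key e 1 0 rfl
    have h3 := key e 1 1 rfl
    simp at h0 h1 h2 h3 ⊢
    refine ⟨by linarith, fun k hk => ?_⟩
    fin_cases k <;> simp at hk ⊢ <;> linarith
  · have h0 := key 0 e 0 rfl
    have h1 := key 0 e 1 rfl
    have h2 := key 1 e 0 rfl
    have h3 := key 1 e 1 rfl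
    simp at h0 h1 h2 h3 ⊢
    refine ⟨by linarith, fun k hk => ?_⟩
    fin_cases k <;> simp at hk ⊢ <;> linarith
  · have h0 := key 0 0 e rfl
    have h1 := key 0 1 e rfl
    have h2 := key 1 0 e rfl
    have h3 := key 1 1 e rfl
    simp at h0 h1 h2 h3 ⊢
    refine ⟨by linarith, fun k hk => ?_⟩
    fin_cases k <;> simp at hk ⊢ <;> linarith

theorem eq_zero_of_all_signs {α : ℝ} {β : Fin 3 → ℝ}
    (h : ∀ u : Fin 3 → Fin 2, α + ∑ k, sgn (u k) * β k = 0) : α = 0 ∧ ∀ k, β k = 0 := by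
  have h0 := eq_zero_of_signs (β := β) 0 0 fun u _ => h u
  have h1 := eq_zero_of_signs (β := β) 1 0 fun u _ => h u
  have hβ : ∀ k, β k = 0 := fun k => by
    by_cases hk : k = 0
    · exact h1.2 k (by simp [hk])
    · exact h0.2 k hk
  exact ⟨by simpa [hβ] using h0.1, hβ⟩

/-- A zero of a nonnegative function is a minimum, and flipping `u j` changes the value by `-2 * sgn
(u j) * β j`. -/
theorem sgn_mul_nonpos {α : ℝ} {β : Fin 3 → ℝ}
    (h : ∀ u : Fin 3 → Fin 2, 0 ≤ α + ∑ k, sgn (u k) * β k) {u : Fin 3 → Fin 2}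
    (hu : α + ∑ k, sgn (u k) * β k = 0) (j : Fin 3) : sgn (u j) * β j ≤ 0 := by
  have h1 := h (Function.update u j (u j + 1))
  simp only [Fin.sum_univ_three] at h1 hu
  fin_cases j <;> simp [sgn_add] at h1 ⊢ <;> linarith

/-! ### The dimension -/

theorem span_convexHull {E : Type} [AddCommGroup E] [Module ℝ E] (V : Set E) :
    Submodule.span ℝ (convexHull ℝ V) = Submodule.span ℝ V :=
  le_antisymm (Submodule.span_le.2 (convexHull_min Submodule.subset_span (Submodule.convex _)))
    (Submodule.span_mono (subset_convexHull ℝ V))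

theorem span_vertex : Submodule.span ℝ (Set.range vertex) =
    Submodule.span ℝ (Set.range fun o : Option (Fin 3) × Option (Fin 3) =>
      tens (octBase o.1) (cubeBase o.2)) := by
  apply le_antisymm
  · rw [Submodule.span_le]
    rintro _ ⟨⟨u, i, s⟩, rfl⟩
    have hmem : ∀ o o', tens (octBase o) (cubeBase o') ∈
        Submodule.span ℝ (Set.range fun o : Option (Fin 3) × Option (Fin 3) =>
          tens (octBase o.1) (cubeBase o.2)) := fun o o' => Submodule.subset_span ⟨(o, o'), rfl⟩
    simp only [vertex, response_octahedron, response_cube, map_add, map_smul, map_sum,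
      LinearMap.add_apply, LinearMap.smul_apply, LinearMap.sum_apply]
    exact add_mem (add_mem (hmem _ _) (sum_mem fun j _ => Submodule.smul_mem _ _ (hmem _ _)))
      (Submodule.smul_mem _ _ (add_mem (hmem _ _)
        (sum_mem fun j _ => Submodule.smul_mem _ _ (hmem _ _))))
  · rw [Submodule.span_le]
    rintro _ ⟨⟨o, o'⟩, rfl⟩
    -- A functional killing all vertices has all 16 coefficients zero: comparing `s = 0` with `s =
    -- 1` separates the coefficients that carry `sgn s` from those that do not.
    by_contra hnot
    obtain ⟨ψ, hψx, hψ⟩ := Submodule.exists_dual_map_eq_bot_of_notMem hnot inferInstance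
    have hv : ∀ w, ψ (vertex w) = 0 := fun w => by
      have : ψ (vertex w) ∈ (Submodule.span ℝ (Set.range vertex)).map ψ :=
        Submodule.mem_map_of_mem (Submodule.subset_span ⟨w, rfl⟩)
      rw [hψ] at this
      simpa using this
    have h0 := fun i => eq_zero_of_all_signs fun u => (apply_vertex ψ u i 0).symm.trans (hv _)
    have h1 := fun i => eq_zero_of_all_signs fun u => (apply_vertex ψ u i 1).symm.trans (hv _)
    simp only [sgn_zero, sgn_one] at h0 h1
    apply hψx
    rcases o with _ | j <;> rcases o' with _ | i
    · linarith [(h0 0).1, (h1 0).1]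
    · linarith [(h0 i).1, (h1 i).1]
    · linarith [(h0 0).2 j, (h1 0).2 j]
    · linarith [(h0 i).2 j, (h1 i).2 j]

theorem linearIndependent_base : LinearIndependent ℝ
    fun o : Option (Fin 3) × Option (Fin 3) => tens (octBase o.1) (cubeBase o.2) := by
  rw [Fintype.linearIndependent_iff]
  rintro g hg ⟨o, o'⟩
  have := congrArg (coord o o') hg
  simp only [map_sum, map_smul, coord_tens, smul_eq_mul, map_zero] at this
  rw [Finset.sum_eq_single (o, o')] at this
  · simpa using this
  · rintro ⟨q, q'⟩ _ hne
    rw [if_neg, mul_zero]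
    rintro ⟨rfl, rfl⟩
    exact hne rfl
  · simp

theorem vertex_mem_polytope (w : (Fin 3 → Fin 2) × (Fin 3 × Fin 2)) :
    vertex w ∈ octCubePolytope :=
  subset_convexHull ℝ _ ⟨w, rfl⟩

theorem affDim_octCubePolytope : affDim octCubePolytope = 15 := by
  have h := affDim_add_one (F := octCubePolytope) ⟨_, vertex_mem_polytope (0, 0)⟩ (coord none none)
    fun p hp => coord_eq_one hp
  rw [octCubePolytope, span_convexHull, span_vertex,
    finrank_span_eq_card linearIndependent_base] at h
  -- The span has rank 4·4 = 16; passing to the affine span costs one.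
  simp at h
  exact h

/-! ### The nontrivial facets -/

/-- An affine Boolean function of at most one of the outcomes assigned to the octahedron settings:
`(none, s)` is the constant `s` and `(some j, s)` is `u ↦ s + u j`. -/
abbrev Literal : Type := Option (Fin 3) × Fin 2

/-- The value of a literal. -/
def Literal.eval (l : Literal) (u : Fin 3 → Fin 2) : Fin 2 := l.2 + l.1.elim 0 u

/-- The functional whose value at the vertex `(u, i, s)` is the bit `s + τ i u`. -/
noncomputable def facetForm (τ : Fin 3 → Literal) : Stats (Fin 2) (Fin 2) (Fin 3) (Fin 4) →ₗ[ℝ] ℝ :=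
  (1 / 2 : ℝ) • (coord none none - ∑ i, sgn (τ i).2 • coord (τ i).1 (some i))

theorem facetForm_vertex' (τ : Fin 3 → Literal) (u : Fin 3 → Fin 2) (i : Fin 3) (s : Fin 2) :
    facetForm τ (vertex (u, i, s)) = (1 - sgn ((τ i).eval u + s)) / 2 := by
  have hc : ∀ k, coord (τ k).1 (some k) (vertex (u, i, s)) =
      if k = i then sgn ((τ k).1.elim 0 u) * sgn s else 0 := by
    intro k
    rw [apply_vertex]
    simp only [coord_tens]
    rcases (τ k).1 with _ | j
    · by_cases hk : k = i <;> simp [hk]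
    · by_cases hk : k = i
      · simp [hk]
      · simp [hk]
  simp only [facetForm, LinearMap.smul_apply, LinearMap.sub_apply, coord_vertex,
    LinearMap.sum_apply, hc, smul_eq_mul, mul_ite, mul_zero, Finset.sum_ite_eq', Finset.mem_univ,
    if_true, Literal.eval, sgn_add]
  ring

theorem facetForm_vertex (τ : Fin 3 → Literal) (u : Fin 3 → Fin 2) (v : Fin 3 × Fin 2) :
    facetForm τ (vertex (u, v)) = if (τ v.1).eval u + v.2 = 0 then 0 else 1 := by
  obtain ⟨i, s⟩ := v
  rw [facetForm_vertex']
  by_cases h : (τ i).eval u + s = 0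
  · simp [h]
  · rw [eq_add_one_of_ne h]
    norm_num

theorem facetForm_vertex_eq_zero {τ : Fin 3 → Literal} {u : Fin 3 → Fin 2} {v : Fin 3 × Fin 2} :
    facetForm τ (vertex (u, v)) = 0 ↔ (τ v.1).eval u + v.2 = 0 := by
  rw [facetForm_vertex]
  split_ifs with h <;> simp [h]

theorem facetForm_nonneg (τ : Fin 3 → Literal) {p : Stats (Fin 2) (Fin 2) (Fin 3) (Fin 4)}
    (hp : p ∈ octCubePolytope) : 0 ≤ facetForm τ p := by
  refine (convexHull_zero_imp_zero (ψ := 0) ?_ (by simp) p hp).1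
  rintro _ ⟨⟨u, v⟩, rfl⟩
  rw [facetForm_vertex]
  split_ifs <;> norm_num

/-- At least two different octahedron settings occur in `τ`. -/
def TwoAxes (τ : Fin 3 → Literal) : Prop :=
  ∃ i k, (τ i).1 ≠ none ∧ (τ k).1 ≠ none ∧ (τ i).1 ≠ (τ k).1

instance : DecidablePred TwoAxes := fun τ => by unfold TwoAxes; infer_instance

/-- The face of the polytope on which `facetForm τ` vanishes. -/
def facetOf (τ : Fin 3 → Literal) : Set (Stats (Fin 2) (Fin 2) (Fin 3) (Fin 4)) :=
  {p ∈ octCubePolytope | facetForm τ p = 0}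

theorem vertex_mem_facetOf {τ : Fin 3 → Literal} {u : Fin 3 → Fin 2} {v : Fin 3 × Fin 2} :
    vertex (u, v) ∈ facetOf τ ↔ (τ v.1).eval u + v.2 = 0 := by
  rw [← facetForm_vertex_eq_zero]
  exact ⟨fun h => h.2, fun h => ⟨vertex_mem_polytope _, h⟩⟩

/-- The vertices `(u, i, 0)` on the face are the zeros of the literal `τ i`, and a literal is
determined by its zeros. -/
theorem facetOf_injective : Function.Injective facetOf := by
  intro τ τ' h
  have hinj : ∀ l l' : Literal, (∀ u, l.eval u = 0 ↔ l'.eval u = 0) → l = l' := by decide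
  funext i
  refine hinj _ _ fun u => ?_
  have := vertex_mem_facetOf (τ := τ) (u := u) (v := (i, 0))
  rw [h, vertex_mem_facetOf] at this
  simpa using this.symm

theorem exists_facetForm_zero (τ : Fin 3 → Literal) :
    ∃ p ∈ octCubePolytope, facetForm τ p = 0 :=
  ⟨_, vertex_mem_polytope (0, 0, (τ 0).eval 0), by
    rw [facetForm_vertex_eq_zero]
    generalize (τ 0).eval 0 = e
    revert e; decide⟩

theorem exists_facetForm_ne_zero (τ : Fin 3 → Literal) :
    ∃ p ∈ octCubePolytope, facetForm τ p ≠ 0 :=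
  ⟨_, vertex_mem_polytope (0, 0, (τ 0).eval 0 + 1), by
    rw [Ne, facetForm_vertex_eq_zero]
    generalize (τ 0).eval 0 = e
    revert e; decide⟩

/-- Over each `i` the zeros form a full sign cube (constant literal) or two opposite faces, one for
each `s`. A literal on axis `j` forces `w k = 0` for `k ≠ j`, so two different axes force `w = 0`;
then `t` determines every value at the vertices. -/
theorem facetForm_unique {τ : Fin 3 → Literal} (hτ : TwoAxes τ)
    {ψ : Stats (Fin 2) (Fin 2) (Fin 3) (Fin 4) →ₗ[ℝ] ℝ}
    (hψ : ∀ w, facetForm τ (vertex w) = 0 → ψ (vertex w) = 0) :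
    ∃ c : ℝ, ∀ w, ψ (vertex w) = c * facetForm τ (vertex w) := by
  set t := ψ (tens (octBase none) (cubeBase none))
  set a := fun i => ψ (tens (octBase none) (cubeBase (some i)))
  set w := fun j => ψ (tens (octBase (some j)) (cubeBase none))
  set b := fun i j => ψ (tens (octBase (some j)) (cubeBase (some i)))
  have hv : ∀ u i s, ψ (vertex (u, i, s)) =
    t + sgn s * a i + ∑ j, sgn (u j) * (w j + sgn s * b i j) := fun u i s => apply_vertex ψ u i s
  have hz : ∀ u i s, (τ i).eval u + s = 0 →
      t + sgn s * a i + ∑ j, sgn (u j) * (w j + sgn s * b i j) = 0 := fun u i s h => by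
    rw [← hv]
    exact hψ _ (facetForm_vertex_eq_zero.2 h)
  have hconst : ∀ i e, τ i = (none, e) →
      t + sgn e * a i = 0 ∧ ∀ j, w j + sgn e * b i j = 0 := fun i e h =>
    eq_zero_of_all_signs fun u => hz u i e (by
      have bit : ∀ e : Fin 2, e + 0 + e = 0 := by decide
      rw [h]; exact bit e)
  have hlit : ∀ i j e, τ i = (some j, e) →
      (t + sgn e * b i j = 0 ∧ a i + sgn e * w j = 0) ∧ ∀ k, k ≠ j → w k = 0 ∧ b i k = 0 := by
    intro i j e h
    have h0 := eq_zero_of_signs j e fun u hu => hz u i 0 (by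
      have bit : ∀ e : Fin 2, e + e + 0 = 0 := by decide
      simp only [h, Literal.eval, Option.elim, hu, bit])
    have h1 := eq_zero_of_signs j (e + 1) fun u hu => hz u i 1 (by
      have bit : ∀ e : Fin 2, e + (e + 1) + 1 = 0 := by decide
      simp only [h, Literal.eval, Option.elim, hu, bit])
    simp only [sgn_add, sgn_zero, sgn_one] at h0 h1
    refine ⟨⟨by linarith [h0.1, h1.1], by linarith [h0.1, h1.1]⟩, fun k hk => ⟨?_, ?_⟩⟩ <;>
      linarith [h0.2 k hk, h1.2 k hk]
  have hw : ∀ j, w j = 0 := by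
    obtain ⟨i, k, hi, hk, hne⟩ := hτ
    obtain ⟨j, hj⟩ := Option.ne_none_iff_exists'.1 hi
    obtain ⟨j', hj'⟩ := Option.ne_none_iff_exists'.1 hk
    have h1 := (hlit i j (τ i).2 (Prod.ext hj rfl)).2
    have h2 := (hlit k j' (τ k).2 (Prod.ext hj' rfl)).2
    intro l
    by_cases hl : l = j
    · exact (h2 l (by rintro rfl; exact hne (by rw [hj, hj', hl]))).1
    · exact (h1 l hl).1
  -- `facetForm` takes the form `(1 - sign) / 2`, whereas `ψ` turns out to be `t * (1 - sign)`.
  refine ⟨2 * t, ?_⟩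
  rintro ⟨u, i, s⟩
  rw [hv, facetForm_vertex']
  rcases hi : τ i with ⟨_ | j, e⟩
  · obtain ⟨h1, h2⟩ := hconst i e hi
    have hb : ∀ j, b i j = 0 := fun j => by
      have := h2 j
      rw [hw, zero_add] at this
      have h3 := congrArg (sgn e * ·) this
      simpa [← mul_assoc, sgn_mul_self] using h3
    simp only [hw, hb, Literal.eval, Option.elim, sgn_add, sgn_zero]
    simp
    linear_combination (sgn e * sgn s) * h1 - sgn s * a i * sgn_mul_self e
  · obtain ⟨⟨h1, h2⟩, h3⟩ := hlit i j e hi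
    rw [Finset.sum_eq_single j (fun k _ hk => by simp [h3 k hk]) (by simp)]
    simp only [hw, Literal.eval, Option.elim, sgn_add] at h2 ⊢
    have ha : a i = 0 := by simpa using h2
    rw [ha]
    linear_combination (sgn e * sgn s * sgn (u j)) * h1 - sgn s * sgn (u j) * b i j * sgn_mul_self e

theorem isFacet_facetOf {τ : Fin 3 → Literal} (hτ : TwoAxes τ) :
    IsFacet octCubePolytope (facetOf τ) := by
  refine isFacet_of_unique (coord none none) (fun p hp => coord_eq_one hp)
    (fun p hp => facetForm_nonneg τ hp) (exists_facetForm_ne_zero τ) (exists_facetForm_zero τ) ?_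
  intro ψ hψ
  obtain ⟨c, hc⟩ := facetForm_unique hτ fun w hw => hψ _ (vertex_mem_polytope w) hw
  refine ⟨c, fun p hp => ?_⟩
  have h := (convexHull_zero_imp_zero (V := Set.range vertex) (φ := 0) (ψ := ψ - c • facetForm τ)
    (by simp) (by rintro _ ⟨w, rfl⟩ _; simp [hc w]) p hp).2 rfl
  simpa [sub_eq_zero] using h

/-- Every choice of one sign per coordinate is a vertex of the cube, hence an event `b|y` of the
second party. -/
theorem exists_cube_vertex (s : Fin 3 → Fin 2) :
    ∃ b y, ∀ v, cubeOutcome v y = b → v.2 = s v.1 := by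
  revert s; decide

theorem exists_cubeOutcome_ne (b : Fin 2) (y : Fin 4) (i : Fin 3) : ∃ s, cubeOutcome (i, s) y ≠ b := by
  revert b y i; decide

/-- Where `cubeOutcome (i, s) y ≠ b`, the probability vanishes for every `u`, while a nonconstant
literal at `i` admits only some `u`. -/
theorem facetOf_ne_trivial {τ : Fin 3 → Literal} (hτ : TwoAxes τ) (a b : Fin 2) (x : Fin 3)
    (y : Fin 4) : facetOf τ ≠ {p ∈ octCubePolytope | p a b x y = 0} := by
  intro h
  obtain ⟨i, k, hi, -⟩ := hτ
  obtain ⟨j, hj⟩ := Option.ne_none_iff_exists'.1 hi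
  obtain ⟨s, hs⟩ := exists_cubeOutcome_ne b y i
  have hmem : vertex (fun _ => s + (τ i).2 + 1, i, s) ∈ facetOf τ := by
    rw [h]
    exact ⟨vertex_mem_polytope _, by rw [vertex_apply, if_neg]; exact fun h => hs h.2⟩
  rw [vertex_mem_facetOf] at hmem
  simp only [Literal.eval, hj, Option.elim] at hmem
  have bit : ∀ e s : Fin 2, e + (s + e + 1) + s ≠ 0 := by decide
  exact bit _ _ hmem

/-- Every supporting functional of the polytope vanishes on at most a face of one of the two known
kinds. -/
theorem exists_zero_superset {g : Stats (Fin 2) (Fin 2) (Fin 3) (Fin 4) →ₗ[ℝ] ℝ}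
    (hg : ∀ w, 0 ≤ g (vertex w)) (hne : ∃ w, g (vertex w) ≠ 0) :
    (∃ a b x y, ∀ w, g (vertex w) = 0 → vertex w a b x y = 0) ∨
      ∃ τ, TwoAxes τ ∧ ∀ w, g (vertex w) = 0 → facetForm τ (vertex w) = 0 := by
  -- Zeros that avoid `u x = a` whenever the sign over `i` is `s i` lie in a nonnegativity face: the
  -- event `b|y` belonging to `s` occurs only at those signs.
  have htriv : ∀ (a : Fin 2) (x : Fin 3) (s : Fin 3 → Fin 2),
      (∀ u i, g (vertex (u, i, s i)) = 0 → u x ≠ a) →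
      ∃ a b x y, ∀ w, g (vertex w) = 0 → vertex w a b x y = 0 := by
    intro a x s h
    obtain ⟨b, y, hby⟩ := exists_cube_vertex s
    refine ⟨a, b, x, y, ?_⟩
    rintro ⟨u, i, r⟩ hw
    rw [vertex_apply, if_neg]
    rintro ⟨h1, h2⟩
    have hr : r = s i := hby _ h2
    subst hr
    exact h u i hw h1
  set t := g (tens (octBase none) (cubeBase none))
  set a := fun i => g (tens (octBase none) (cubeBase (some i)))
  set w := fun j => g (tens (octBase (some j)) (cubeBase none))
  set b := fun i j => g (tens (octBase (some j)) (cubeBase (some i)))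
  have hv : ∀ u i s, g (vertex (u, i, s)) =
    t + sgn s * a i + ∑ j, sgn (u j) * (w j + sgn s * b i j) := fun u i s => apply_vertex g u i s
  have hZ : ∀ u i s, g (vertex (u, i, s)) = 0 → ∀ j, sgn (u j) * (w j + sgn s * b i j) ≤ 0 := by
    intro u i s h j
    rw [hv] at h
    exact sgn_mul_nonpos (fun u => (hv u i s) ▸ hg _) h j
  by_cases hw : ∃ j, w j ≠ 0
  · left
    obtain ⟨j, hj⟩ := hw
    obtain ⟨e, he⟩ := exists_sgn_mul_pos hj
    -- At least one of `w j + b i j` and `w j - b i j` has the strict sign of `w j`.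
    have hs : ∀ i, ∃ s, 0 < sgn e * (w j + sgn s * b i j) := by
      intro i
      rcases le_total 0 (sgn e * b i j) with h | h
      · exact ⟨0, by rw [sgn_zero]; linarith⟩
      · exact ⟨1, by rw [sgn_one]; linarith⟩
    choose s hs using hs
    refine htriv e j s fun u i h0 hu => ?_
    have := hZ u i (s i) h0 j
    rw [hu] at this
    exact absurd (hs i) (not_lt.2 this)
  · push Not at hw
    simp only [hw, zero_add] at hv hZ
    -- Since `w = 0`, the values at `s` and `s + 1` add up to `2 * t`. Positivity of `t` also
    -- prevents both signs from giving zeros when the literal is constant.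
    have ht : 0 < t := by
      obtain ⟨⟨u, i, s⟩, h⟩ := hne
      have h1 := lt_of_le_of_ne (hg (u, i, s)) h.symm
      have h2 := hg (u, i, s + 1)
      rw [hv] at h1 h2
      simp only [sgn_add, sgn_one, mul_neg, mul_one, neg_mul, Finset.sum_neg_distrib] at h2
      linarith
    -- At a zero, `sgn s * sgn (u j)` is opposite in sign to `b i j`, so `u j` determines `s`. If
    -- several `b i j` are nonzero, any one of them will do.
    have hl : ∀ i, ∃ l : Literal, ∀ u s, g (vertex (u, i, s)) = 0 → l.eval u + s = 0 := by
      intro i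
      by_cases hb : ∃ j, b i j ≠ 0
      · obtain ⟨j, hj⟩ := hb
        obtain ⟨e, he⟩ := exists_sgn_mul_pos hj
        refine ⟨(some j, e + 1), fun u s h0 => ?_⟩
        have h1 := hZ u i s h0 j
        rw [← mul_assoc, ← sgn_add] at h1
        have h2 := eq_of_sgn_mul_nonpos he h1
        simp only [Literal.eval, Option.elim]
        have bit : ∀ e r s : Fin 2, r + s = e + 1 → e + 1 + r + s = 0 := by decide
        exact bit _ _ _ h2
      · push Not at hb
        have hv' : ∀ u s, g (vertex (u, i, s)) = t + sgn s * a i := fun u s => by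
          rw [hv]
          simp [hb]
        by_cases h0 : t + a i = 0
        · refine ⟨(none, 0), fun u s h => ?_⟩
          rw [hv'] at h
          fin_cases s
          · rfl
          · simp at h
            linarith
        · refine ⟨(none, 1), fun u s h => ?_⟩
          rw [hv'] at h
          fin_cases s
          · simp at h
            exact absurd h h0
          · rfl
    choose τ hτ using hl
    by_cases h2 : TwoAxes τ
    · right
      refine ⟨τ, h2, ?_⟩
      rintro ⟨u, i, s⟩ h
      exact facetForm_vertex_eq_zero.2 (hτ i u s h)
    · left
      obtain ⟨j, hj⟩ : ∃ j, ∀ i, (τ i).1 = none ∨ (τ i).1 = some j := by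
        by_cases hn : ∃ i, (τ i).1 ≠ none
        · obtain ⟨i, hi⟩ := hn
          obtain ⟨j, hj⟩ := Option.ne_none_iff_exists'.1 hi
          refine ⟨j, fun k => ?_⟩
          by_contra hk
          push Not at hk
          exact h2 ⟨i, k, hi, hk.1, hj ▸ hk.2.symm⟩
        · push Not at hn
          exact ⟨0, fun i => Or.inl (hn i)⟩
      -- With only one axis `j`, setting `u j = 0` reduces each literal to its constant bit, so no
      -- zero has `u j = 0` and the opposite sign.
      refine htriv 0 j (fun i => (τ i).2 + 1) fun u i h0 hu => ?_
      have h1 := hτ i u _ h0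
      have h3 : (τ i).1.elim 0 u = 0 := by
        rcases hj i with h | h <;> simp [h, hu]
      rw [Literal.eval, h3] at h1
      generalize (τ i).2 = e at h1
      revert e; decide

theorem nontrivialFacets_octCubePolytope :
    nontrivialFacets octCubePolytope = facetOf '' {τ | TwoAxes τ} := by
  ext F
  constructor
  · rintro ⟨hF, hnt⟩
    have hF' := hF
    obtain ⟨⟨p, hp⟩, hexp, hdim⟩ := hF'
    obtain ⟨l, hl⟩ := hexp ⟨p, hp⟩
    have hpF := hp
    rw [hl] at hp
    -- The exposing functional, homogenised to be nonnegative on the polytope and zero on `F`.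
    set g : Stats (Fin 2) (Fin 2) (Fin 3) (Fin 4) →ₗ[ℝ] ℝ :=
      l p • coord none none - (l : Stats (Fin 2) (Fin 2) (Fin 3) (Fin 4) →ₗ[ℝ] ℝ) with hgdef
    have hgP : ∀ q ∈ octCubePolytope, g q = l p - l q := fun q hq => by
      simp [hgdef, coord_eq_one hq]
    have hg : ∀ w, 0 ≤ g (vertex w) := fun w => by
      rw [hgP _ (vertex_mem_polytope w)]
      exact sub_nonneg.2 (hp.2 _ (vertex_mem_polytope w))
    have hgF : ∀ q ∈ F, g q = 0 := by
      intro q hq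
      rw [hl] at hq
      rw [hgP q hq.1]
      exact sub_eq_zero.2 (le_antisymm (hq.2 p hp.1) (hp.2 q hq.1))
    have hne : ∃ w, g (vertex w) ≠ 0 := by
      by_contra h
      push Not at h
      have hall : ∀ q ∈ octCubePolytope, g q = 0 := fun q hq =>
        (convexHull_zero_imp_zero (V := Set.range vertex) (φ := 0) (ψ := g)
          (by simp) (by rintro _ ⟨w, rfl⟩ _; exact h w) q hq).2 rfl
      have hFP : F = octCubePolytope := by
        refine Set.Subset.antisymm hexp.subset fun q hq => ?_
        have h1 := hall q hq
        rw [hgP q hq, sub_eq_zero] at h1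
        rw [hl]
        exact ⟨hq, fun r hr => h1 ▸ hp.2 r hr⟩
      rw [hFP] at hdim
      omega
    have hzero : ∀ φ : Stats (Fin 2) (Fin 2) (Fin 3) (Fin 4) →ₗ[ℝ] ℝ,
        (∀ w, g (vertex w) = 0 → φ (vertex w) = 0) → (∃ q ∈ octCubePolytope, φ q ≠ 0) →
        F = {q ∈ octCubePolytope | φ q = 0} := by
      intro φ hφ hne'
      refine hF.eq_of_subset (coord none none) (fun q hq => coord_eq_one hq) hne' fun q hq => ?_
      exact (convexHull_zero_imp_zero (V := Set.range vertex) (φ := g) (ψ := φ)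
        (by rintro _ ⟨w, rfl⟩; exact hg w) (by rintro _ ⟨w, rfl⟩; exact hφ w) q
        (hexp.subset hq)).2 (hgF q hq)
    rcases exists_zero_superset hg hne with ⟨a, b, x, y, h⟩ | ⟨τ, hτ, h⟩
    · exfalso
      let φ : Stats (Fin 2) (Fin 2) (Fin 3) (Fin 4) →ₗ[ℝ] ℝ :=
        { toFun := fun q => q a b x y, map_add' := fun _ _ => rfl, map_smul' := fun _ _ => rfl }
      refine hnt a b x y (hzero φ h ⟨_, vertex_mem_polytope (fun _ => a, 0, b), ?_⟩)
      have bit : ∀ b y, cubeOutcome (0, b) y = b := by decide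
      simp [φ, vertex_apply, bit]
    · exact ⟨τ, hτ, (hzero _ h (exists_facetForm_ne_zero τ)).symm⟩
  · rintro ⟨τ, hτ, rfl⟩
    exact ⟨isFacet_facetOf hτ, facetOf_ne_trivial hτ⟩

/-- Of the 8³ = 512 labels, 3·(4³ − 2³) + 2³ = 176 use at most one axis. -/
theorem ncard_nontrivialFacets : (nontrivialFacets octCubePolytope).ncard = 336 := by
  rw [nontrivialFacets_octCubePolytope, Set.ncard_image_of_injective _ facetOf_injective,
    Set.ncard_eq_toFinset_card']
  decide +kernel

/-! ### Trivial identities and the identities of the octahedron and the cube -/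

theorem mem_trivialIdentities {A X : Type} [Fintype X] [DecidableEq X] [Nonempty X]
    {α : A → X → ℝ} : α ∈ trivialIdentities A X ↔ ∃ c : X → ℝ, ∑ x, c x = 0 ∧ α = fun _ => c := by
  constructor
  · intro h
    change α ∈ Submodule.span ℝ _ at h
    induction h using Submodule.span_induction with
    | mem α h =>
      obtain ⟨x, x', rfl⟩ := h
      exact ⟨_, by simp, rfl⟩
    | zero => exact ⟨0, by simp, rfl⟩
    | add α β _ _ hα hβ =>
      obtain ⟨c, hc, rfl⟩ := hα
      obtain ⟨d, hd, rfl⟩ := hβ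
      exact ⟨c + d, by simp [Finset.sum_add_distrib, hc, hd], rfl⟩
    | smul r α _ hα =>
      obtain ⟨c, hc, rfl⟩ := hα
      exact ⟨r • c, by simp [← Finset.mul_sum, hc], rfl⟩
  · rintro ⟨c, hc, rfl⟩
    obtain ⟨x₀⟩ := ‹Nonempty X›
    have h : (fun _ : A => c) =
        ∑ x, c x • (fun _ : A => (Pi.single x 1 - Pi.single x₀ 1 : X → ℝ)) := by
      funext a y
      simp only [Finset.sum_apply, Pi.smul_apply, Pi.sub_apply, smul_eq_mul, mul_sub,
        Finset.sum_sub_distrib, ← Finset.sum_mul, hc, zero_mul, sub_zero]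
      simp [Pi.single_apply]
    rw [h]
    change _ ∈ Submodule.span ℝ _
    exact sum_mem fun x _ => Submodule.smul_mem _ _ (Submodule.subset_span ⟨x, x₀, rfl⟩)

theorem sum_trivial_mul {A X : Type} [Fintype A] [Fintype X] [DecidableEq X] [Nonempty X]
    {α : A → X → ℝ} (hα : α ∈ trivialIdentities A X) {f : A → X → ℝ} {r : ℝ}
    (hf : ∀ x, ∑ a, f a x = r) : ∑ a, ∑ x, α a x * f a x = 0 := by
  obtain ⟨c, hc, rfl⟩ := mem_trivialIdentities.1 hα
  rw [Finset.sum_comm]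
  simp [← Finset.mul_sum, hf, ← Finset.sum_mul, hc]

theorem sum_smul_antipodal {X : Type} [Fintype X] (α : Fin 2 → X → ℝ) (m : X → Fin 3 → ℝ)
    (i : Fin 3) : (∑ a, ∑ x, α a x • antipodal m a x) i = ∑ a, ∑ x, α a x * (sgn a * m x i) := by
  simp [Finset.sum_apply, antipodal, sgn]

/-- Each coordinate of a dependency involves a single antipodal pair, so the two coefficients of
that pair agree. -/
theorem vertexIdentities_octahedron :
    vertexIdentities (antipodal octahedronAxis) = trivialIdentities (Fin 2) (Fin 3) := by
  ext α
  rw [mem_trivialIdentities]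
  change (_ ∧ _) ↔ _
  constructor
  · rintro ⟨h0, h1⟩
    have h := fun i => (sum_smul_antipodal α octahedronAxis i).symm.trans (congrFun h1 i)
    have h2 := h 0
    have h3 := h 1
    have h4 := h 2
    simp [Fin.sum_univ_two, Fin.sum_univ_three, octahedronAxis] at h0 h2 h3 h4
    refine ⟨α 0, ?_, ?_⟩
    · rw [Fin.sum_univ_three]
      linarith
    · funext a x
      fin_cases a
      · rfl
      · rcases three_cases x with rfl | rfl | rfl <;> simp <;> linarith
  · rintro ⟨c, hc, rfl⟩
    refine ⟨by simp [hc], ?_⟩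
    funext i
    rw [sum_smul_antipodal]
    simp [Fin.sum_univ_two]

/-- For the opposite labels `(i, 0)` and `(i, 1)`, the sum of the pairings is the total coefficient
and their difference is the `i`-th coordinate of the vector relation. Thus the identities are the
annihilator of six responses. -/
theorem mem_vertexIdentities_cube {α : Fin 2 → Fin 4 → ℝ} :
    α ∈ vertexIdentities (antipodal cubeAxis) ↔
      ∀ v, ∑ b, ∑ y, α b y * response (cubeOutcome v) b y = 0 := by
  have key : ∀ v, ∑ b, ∑ y, α b y * response (cubeOutcome v) b y =
      (1 / 2) * ∑ b, ∑ y, α b y +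
        sgn v.2 / 2 * (∑ b, ∑ y, α b y • antipodal cubeAxis b y) v.1 := by
    intro v
    rw [sum_smul_antipodal, response_cube]
    simp only [Finset.mul_sum, ← Finset.sum_add_distrib, Pi.add_apply, Pi.smul_apply, cubeBase,
      smul_eq_mul]
    refine Finset.sum_congr rfl fun b _ => Finset.sum_congr rfl fun y _ => ?_
    ring
  change (_ ∧ _) ↔ _
  constructor
  · rintro ⟨h0, h1⟩ v
    rw [key, h0, h1]
    simp
  · intro h
    have h0 := fun i => (key (i, 0)).symm.trans (h (i, 0))
    have h1 := fun i => (key (i, 1)).symm.trans (h (i, 1))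
    simp only [sgn_zero, sgn_one] at h0 h1
    refine ⟨by linarith [h0 0, h1 0], ?_⟩
    funext i
    rw [Pi.zero_apply]
    linarith [h0 i, h1 i]

/-- The identity of the cube that is not trivial: it expresses that two diagonals of a rectangle
have the same midpoint. -/
noncomputable def rectangleIdentity : Fin 2 → Fin 4 → ℝ := fun b y => sgn b * ![1, -1, -1, 1] y

theorem rectangleIdentity_mem : rectangleIdentity ∈ vertexIdentities (antipodal cubeAxis) := by
  constructor
  · simp [rectangleIdentity, Fin.sum_univ_two]
  · funext i
    rw [sum_smul_antipodal]
    rcases three_cases i with rfl | rfl | rfl <;>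
      simp [rectangleIdentity, Fin.sum_univ_four, cubeAxis_table]

theorem rectangleIdentity_notMem : rectangleIdentity ∉ trivialIdentities (Fin 2) (Fin 4) := by
  rw [mem_trivialIdentities]
  rintro ⟨c, -, h⟩
  have h0 := congrFun (congrFun h 0) 0
  have h1 := congrFun (congrFun h 1) 0
  simp [rectangleIdentity] at h0 h1
  linarith

theorem sum_response {A X : Type} [Fintype A] [DecidableEq A] (u : X → A) (x : X) :
    ∑ a, response u a x = 1 := by
  simp [response]

theorem response_nonneg {A X : Type} [DecidableEq A] (u : X → A) (a : A) (x : X) :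
    0 ≤ response u a x := by
  unfold response
  split_ifs <;> norm_num

theorem trivialIdentities_subset_cube :
    trivialIdentities (Fin 2) (Fin 4) ⊆ vertexIdentities (antipodal cubeAxis) := fun _ hα =>
  mem_vertexIdentities_cube.2 fun _ => sum_trivial_mul hα (sum_response _)

/-- Assigning outcome `1` to exactly one of the cube settings violates the rectangle identity. -/
theorem sum_rectangleIdentity_ne_zero :
    ∑ b, ∑ y, rectangleIdentity b y * response (fun y : Fin 4 => if y = 0 then (1 : Fin 2) else 0) b y
      ≠ 0 := by
  simp [rectangleIdentity, response, Fin.sum_univ_two, Fin.sum_univ_four]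

/-! ### Realizable statistics -/

section Realizable

variable {A B X Y : Type} [Fintype A] [Fintype B]

theorem OntologicalModel.stats_eq {m n : ℕ} (Λ : OntologicalModel A B X Y m n) :
    Λ.stats = ∑ k, ∑ l, Λ.μ k l • tens (fun a x => Λ.ξA a x k) (fun b y => Λ.ξB b y l) := by
  funext a b x y
  simp [OntologicalModel.stats, Finset.sum_apply, mul_assoc]

/-- The model with a single ontic state and deterministic responses. -/
def deterministicModel [DecidableEq A] [DecidableEq B] (u : X → A) (v : Y → B) :
    OntologicalModel A B X Y 1 1 where
  μ _ _ := 1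
  μ_nonneg _ _ := zero_le_one
  μ_sum := by simp
  ξA a x _ := response u a x
  ξA_nonneg a x _ := response_nonneg u a x
  ξA_sum x _ := sum_response u x
  ξB b y _ := response v b y
  ξB_nonneg b y _ := response_nonneg v b y
  ξB_sum y _ := sum_response v y

theorem deterministicModel_stats [DecidableEq A] [DecidableEq B] (u : X → A) (v : Y → B) :
    (deterministicModel u v).stats = tens (response u) (response v) := by
  funext a b x y
  simp [OntologicalModel.stats, deterministicModel]

variable [Fintype X] [Fintype Y]

theorem realizable_anti {I J : Set (OpIdentity A B X Y)} (h : I ⊆ J) :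
    realizable J ⊆ realizable I := fun _ ⟨m, n, Λ, hΛ, hp⟩ =>
  ⟨m, n, Λ, fun o ho => hΛ o (h ho), hp⟩

theorem OntologicalModel.respects_trivial [DecidableEq X] [DecidableEq Y] [Nonempty X] [Nonempty Y]
    {m n : ℕ} (Λ : OntologicalModel A B X Y m n) :
    (∀ α ∈ trivialIdentities A X, Λ.Respects (.onN α)) ∧
    (∀ β ∈ trivialIdentities B Y, Λ.Respects (.onM β)) ∧
    (∀ α ∈ trivialIdentities A X, Λ.Respects (.onNρ α)) ∧
    (∀ β ∈ trivialIdentities B Y, Λ.Respects (.onMρ β)) := by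
  refine ⟨fun α hα k => sum_trivial_mul hα fun x => Λ.ξA_sum x k,
    fun β hβ l => sum_trivial_mul hβ fun y => Λ.ξB_sum y l,
    fun α hα l => sum_trivial_mul (r := ∑ k, Λ.μ k l) hα fun x => ?_,
    fun β hβ k => sum_trivial_mul (r := ∑ l, Λ.μ k l) hβ fun y => ?_⟩
  · rw [Finset.sum_comm]
    simp [← Finset.sum_mul, Λ.ξA_sum]
  · rw [Finset.sum_comm]
    simp [← Finset.sum_mul, Λ.ξB_sum]

/-- The marginal is a mixture of responses. This yields a test on the statistics alone, independent
of the model. -/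
theorem OntologicalModel.sum_stats_onM {m n : ℕ} (Λ : OntologicalModel A B X Y m n)
    {β : B → Y → ℝ} (h : Λ.Respects (.onM β)) (x : X) :
    ∑ b, ∑ y, β b y * ∑ a, Λ.stats a b x y = 0 := by
  have e : ∀ b y, ∑ a, Λ.stats a b x y = ∑ l, (∑ k, Λ.μ k l) * Λ.ξB b y l := by
    intro b y
    simp only [OntologicalModel.stats, Finset.sum_mul]
    rw [Finset.sum_comm, Finset.sum_comm (s := Finset.univ (α := Fin n))]
    refine Finset.sum_congr rfl fun k _ => ?_
    rw [Finset.sum_comm]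
    refine Finset.sum_congr rfl fun l _ => ?_
    rw [← Finset.sum_mul, ← Finset.mul_sum, Λ.ξA_sum, mul_one]
  have h' : ∀ l, ∑ b, ∑ y, β b y * Λ.ξB b y l = 0 := h
  calc ∑ b, ∑ y, β b y * ∑ a, Λ.stats a b x y
      = ∑ b, ∑ y, ∑ l, (∑ k, Λ.μ k l) * (β b y * Λ.ξB b y l) := by
        simp only [e, Finset.mul_sum, mul_left_comm]
    _ = ∑ l, (∑ k, Λ.μ k l) * ∑ b, ∑ y, β b y * Λ.ξB b y l := by
        simp only [Finset.mul_sum (s := Finset.univ (α := B)),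
          Finset.mul_sum (s := Finset.univ (α := Y))]
        rw [Finset.sum_comm (s := Finset.univ (α := Fin n))]
        refine Finset.sum_congr rfl fun b _ => ?_
        rw [Finset.sum_comm]
    _ = 0 := by simp [h']

theorem OntologicalModel.sum_stats_onN {m n : ℕ} (Λ : OntologicalModel A B X Y m n)
    {α : A → X → ℝ} (h : Λ.Respects (.onN α)) (y : Y) :
    ∑ a, ∑ x, α a x * ∑ b, Λ.stats a b x y = 0 := by
  have e : ∀ a x, ∑ b, Λ.stats a b x y = ∑ k, (∑ l, Λ.μ k l) * Λ.ξA a x k := by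
    intro a x
    simp only [OntologicalModel.stats, Finset.sum_mul]
    rw [Finset.sum_comm]
    refine Finset.sum_congr rfl fun k _ => ?_
    rw [Finset.sum_comm]
    refine Finset.sum_congr rfl fun l _ => ?_
    rw [← Finset.mul_sum, Λ.ξB_sum, mul_one]
  have h' : ∀ k, ∑ a, ∑ x, α a x * Λ.ξA a x k = 0 := h
  calc ∑ a, ∑ x, α a x * ∑ b, Λ.stats a b x y
      = ∑ a, ∑ x, ∑ k, (∑ l, Λ.μ k l) * (α a x * Λ.ξA a x k) := by
        simp only [e, Finset.mul_sum, mul_left_comm]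
    _ = ∑ k, (∑ l, Λ.μ k l) * ∑ a, ∑ x, α a x * Λ.ξA a x k := by
        simp only [Finset.mul_sum (s := Finset.univ (α := A)),
          Finset.mul_sum (s := Finset.univ (α := X))]
        rw [Finset.sum_comm (s := Finset.univ (α := Fin m))]
        refine Finset.sum_congr rfl fun b _ => ?_
        rw [Finset.sum_comm]
    _ = 0 := by simp [h']

end Realizable

/-! ### The hierarchy -/

section Hierarchy

variable {A B X Y dA dB : Type} [Fintype A] [Fintype B] [Fintype X] [Fintype Y]
  [DecidableEq X] [DecidableEq Y] [Fintype dA] [Fintype dB] [DecidableEq dA] [DecidableEq dB]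
  (S : BellScenario A B X Y dA dB)

theorem BellScenario.forall_O_respects {m n : ℕ} {Λ : OntologicalModel A B X Y m n}
    {i j u v : Letter} : (∀ o ∈ S.O i j u v, Λ.Respects o) ↔
      (∀ α ∈ selectedIdentities S.N i, Λ.Respects (.onN α)) ∧
      (∀ β ∈ selectedIdentities S.M j, Λ.Respects (.onM β)) ∧
      (∀ α ∈ selectedIdentities S.steerB u, Λ.Respects (.onNρ α)) ∧
      (∀ β ∈ selectedIdentities S.steerA v, Λ.Respects (.onMρ β)) := by
  constructor
  · intro h
    exact ⟨fun α hα => h _ (Or.inl (Or.inl (Or.inl ⟨α, hα, rfl⟩))),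
      fun α hα => h _ (Or.inl (Or.inl (Or.inr ⟨α, hα, rfl⟩))),
      fun α hα => h _ (Or.inl (Or.inr ⟨α, hα, rfl⟩)), fun α hα => h _ (Or.inr ⟨α, hα, rfl⟩)⟩
  · rintro ⟨h1, h2, h3, h4⟩ o (((⟨α, hα, rfl⟩ | ⟨α, hα, rfl⟩) | ⟨α, hα, rfl⟩) | ⟨α, hα, rfl⟩)
    exacts [h1 α hα, h2 α hα, h3 α hα, h4 α hα]

theorem BellScenario.O_congr_left (h : allIdentities S.N = trivialIdentities A X)
    (j u v : Letter) : S.O .a j u v = S.O .t j u v := by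
  simp only [BellScenario.O, selectedIdentities, h]

theorem BellScenario.O_congr_right (h : allIdentities S.M = trivialIdentities B Y)
    (i u v : Letter) : S.O i .a u v = S.O i .t u v := by
  simp only [BellScenario.O, selectedIdentities, h]

theorem BellScenario.O_ssubset_right (h : trivialIdentities B Y ⊆ allIdentities S.M)
    {β : B → Y → ℝ} (hβ : β ∈ allIdentities S.M) (hβ' : β ∉ trivialIdentities B Y)
    (i u v : Letter) : S.O i .t u v ⊂ S.O i .a u v := by
  refine ⟨Set.union_subset_union_left _ (Set.union_subset_union_left _
    (Set.union_subset_union_right _ (Set.image_mono h))), fun hsub => ?_⟩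
  have := hsub (Or.inl (Or.inl (Or.inr ⟨β, hβ, rfl⟩)))
  rcases this with ((⟨α, hα, h⟩ | ⟨α, hα, h⟩) | ⟨α, hα, h⟩) | ⟨α, hα, h⟩ <;> cases h
  exact hβ' hα

theorem BellScenario.O_ssubset_left (h : trivialIdentities A X ⊆ allIdentities S.N)
    {α : A → X → ℝ} (hα : α ∈ allIdentities S.N) (hα' : α ∉ trivialIdentities A X)
    (j u v : Letter) : S.O .t j u v ⊂ S.O .a j u v := by
  refine ⟨Set.union_subset_union_left _ (Set.union_subset_union_left _
    (Set.union_subset_union_left _ (Set.image_mono h))), fun hsub => ?_⟩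
  have := hsub (Or.inl (Or.inl (Or.inl ⟨α, hα, rfl⟩)))
  rcases this with ((⟨α', hα'', h⟩ | ⟨α', hα'', h⟩) | ⟨α', hα'', h⟩) | ⟨α', hα'', h⟩ <;> cases h
  exact hα' hα''

variable [DecidableEq A] [DecidableEq B] [Nonempty X] [Nonempty Y]

theorem BellScenario.tens_mem_NC (u : X → A) (v : Y → B) :
    tens (response u) (response v) ∈ S.NC .t .t .t .t :=
  ⟨1, 1, deterministicModel u v, S.forall_O_respects.2 (OntologicalModel.respects_trivial _),
    deterministicModel_stats u v⟩

/-- A deterministic product strategy satisfies all trivial identities, but its second marginal is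
`response v`, which violates `β`. -/
theorem BellScenario.NC_ssubset_right (h : trivialIdentities B Y ⊆ allIdentities S.M)
    {β : B → Y → ℝ} (hβ : β ∈ allIdentities S.M) (u : X → A) (v : Y → B)
    (hv : ∑ b, ∑ y, β b y * response v b y ≠ 0) : S.NC .t .a .t .t ⊂ S.NC .t .t .t .t := by
  refine ⟨realizable_anti (Set.union_subset_union_left _ (Set.union_subset_union_left _
    (Set.union_subset_union_right _ (Set.image_mono h)))), fun hsub => ?_⟩
  obtain ⟨m, n, Λ, hΛ, hp⟩ := hsub (S.tens_mem_NC u v)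
  obtain ⟨x⟩ := ‹Nonempty X›
  have := Λ.sum_stats_onM ((S.forall_O_respects.1 hΛ).2.1 β hβ) x
  rw [hp] at this
  simp only [tens_apply, ← Finset.sum_mul, sum_response, one_mul] at this
  exact hv this

theorem BellScenario.NC_ssubset_left (h : trivialIdentities A X ⊆ allIdentities S.N)
    {α : A → X → ℝ} (hα : α ∈ allIdentities S.N) (u : X → A) (v : Y → B)
    (hu : ∑ a, ∑ x, α a x * response u a x ≠ 0) : S.NC .a .t .t .t ⊂ S.NC .t .t .t .t := by
  refine ⟨realizable_anti (Set.union_subset_union_left _ (Set.union_subset_union_left _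
    (Set.union_subset_union_left _ (Set.image_mono h)))), fun hsub => ?_⟩
  obtain ⟨m, n, Λ, hΛ, hp⟩ := hsub (S.tens_mem_NC u v)
  obtain ⟨y⟩ := ‹Nonempty Y›
  have := Λ.sum_stats_onN ((S.forall_O_respects.1 hΛ).1 α hα) y
  rw [hp] at this
  simp only [tens_apply, ← Finset.mul_sum, sum_response, mul_one] at this
  exact hu this

end Hierarchy

theorem BellScenario.hierarchy_octahedron_cube {dA dB : Type} [Fintype dA] [Fintype dB]
    [DecidableEq dA] [DecidableEq dB] (S : BellScenario (Fin 2) (Fin 2) (Fin 3) (Fin 4) dA dB)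
    (hN : HasShape S.N (antipodal octahedronAxis)) (hM : HasShape S.M (antipodal cubeAxis)) :
    (S.O .a .a .t .t = S.O .t .a .t .t ∧ S.O .a .t .t .t ⊂ S.O .t .a .t .t ∧
      S.O .a .t .t .t = S.O .t .t .t .t) ∧
    (S.NC .a .a .t .t = S.NC .t .a .t .t ∧ S.NC .t .a .t .t ⊂ S.NC .a .t .t .t ∧
      S.NC .a .t .t .t = S.NC .t .t .t .t) := by
  have hN' := hN.trans vertexIdentities_octahedron
  have hM' : trivialIdentities (Fin 2) (Fin 4) ⊆ allIdentities S.M :=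
    trivialIdentities_subset_cube.trans hM.ge
  have hr : rectangleIdentity ∈ allIdentities S.M := hM.ge rectangleIdentity_mem
  have h1 := S.O_congr_left hN' .a .t .t
  have h2 := S.O_congr_left hN' .t .t .t
  refine ⟨⟨h1, h2 ▸ S.O_ssubset_right hM' hr rectangleIdentity_notMem .t .t .t, h2⟩, ?_⟩
  have h3 : S.NC .a .a .t .t = S.NC .t .a .t .t := congrArg realizable h1
  have h4 : S.NC .a .t .t .t = S.NC .t .t .t .t := congrArg realizable h2
  exact ⟨h3, h4 ▸ S.NC_ssubset_right hM' hr 0 _ sum_rectangleIdentity_ne_zero, h4⟩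

theorem BellScenario.hierarchy_cube_octahedron {dA dB : Type} [Fintype dA] [Fintype dB]
    [DecidableEq dA] [DecidableEq dB] (S : BellScenario (Fin 2) (Fin 2) (Fin 4) (Fin 3) dA dB)
    (hN : HasShape S.N (antipodal cubeAxis)) (hM : HasShape S.M (antipodal octahedronAxis)) :
    (S.O .a .a .t .t = S.O .a .t .t .t ∧ S.O .t .a .t .t ⊂ S.O .a .t .t .t ∧
      S.O .t .a .t .t = S.O .t .t .t .t) ∧
    (S.NC .a .a .t .t = S.NC .a .t .t .t ∧ S.NC .a .t .t .t ⊂ S.NC .t .a .t .t ∧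
      S.NC .t .a .t .t = S.NC .t .t .t .t) := by
  have hM' := hM.trans vertexIdentities_octahedron
  have hN' : trivialIdentities (Fin 2) (Fin 4) ⊆ allIdentities S.N :=
    trivialIdentities_subset_cube.trans hN.ge
  have hr : rectangleIdentity ∈ allIdentities S.N := hN.ge rectangleIdentity_mem
  have h1 := S.O_congr_right hM' .a .t .t
  have h2 := S.O_congr_right hM' .t .t .t
  refine ⟨⟨h1, h2 ▸ S.O_ssubset_left hN' hr rectangleIdentity_notMem .t .t .t, h2⟩, ?_⟩
  have h3 : S.NC .a .a .t .t = S.NC .a .t .t .t := congrArg realizable h1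
  have h4 : S.NC .t .a .t .t = S.NC .t .t .t .t := congrArg realizable h2
  exact ⟨h3, h4 ▸ S.NC_ssubset_left hN' hr _ 0 sum_rectangleIdentity_ne_zero, h4⟩

/-! ### The noncontextual polytope -/

/-- Draw the outcomes of all settings independently: `u` gets weight `∏ x, f (u x) x`. -/
theorem mem_convexHull_response {A X : Type} [Fintype A] [DecidableEq A] [Fintype X]
    [DecidableEq X] {f : A → X → ℝ} (hf : ∀ a x, 0 ≤ f a x) (hs : ∀ x, ∑ a, f a x = 1) :
    f ∈ convexHull ℝ (Set.range (response : (X → A) → A → X → ℝ)) := by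
  have h1 : ∑ u : X → A, ∏ x, f (u x) x = 1 := by
    have := Finset.prod_univ_sum (fun _ : X => (Finset.univ : Finset A)) fun x a => f a x
    rw [Fintype.piFinset_univ] at this
    rw [← this]
    simp [hs]
  have h2 : f = ∑ u : X → A, (∏ x, f (u x) x) • response u := by
    funext a x
    -- Inserting the indicator of `a` in the factor at `x` makes the expanded product the marginal
    -- `f a x`.
    have := Finset.prod_univ_sum (fun _ : X => (Finset.univ : Finset A))
      fun x' a' => f a' x' * if x' = x then (if a' = a then 1 else 0) else 1
    rw [Fintype.piFinset_univ, Finset.prod_eq_single x] at this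
    · simp only [if_true, mul_ite, mul_one, mul_zero, Finset.sum_ite_eq', Finset.mem_univ] at this
      rw [this]
      simp only [Finset.sum_apply, Pi.smul_apply, smul_eq_mul, response]
      refine Finset.sum_congr rfl fun u _ => ?_
      have e : ∀ x', (if x' = x then if u x' = a then f (u x') x' else 0 else f (u x') x') =
          f (u x') x' * if x' = x then (if u x' = a then 1 else 0) else 1 := by
        intro x'
        split_ifs <;> simp
      simp only [e, Finset.prod_mul_distrib, Finset.prod_ite_eq', Finset.mem_univ, if_true]
    · intro x' _ hx'
      simp [hx', hs]
    · simp
  rw [h2]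
  exact (convex_convexHull ℝ _).sum_mem (fun u _ => Finset.prod_nonneg fun x _ => hf _ _) h1
    fun u _ => subset_convexHull ℝ _ ⟨u, rfl⟩

/-- The rectangle identity makes `e y = g 0 y - g 1 y` a linear form `f · cubeAxis y`. The bounds
`|e y| ≤ 1` over all sign patterns say that `f` has ℓ¹ norm at most 1, so it is a mixture of signed
unit vectors. -/
theorem mem_convexHull_cubeOutcome {g : Fin 2 → Fin 4 → ℝ} (hg : ∀ b y, 0 ≤ g b y)
    (hs : ∀ y, ∑ b, g b y = 1)
    (hid : ∀ β ∈ vertexIdentities (antipodal cubeAxis), ∑ b, ∑ y, β b y * g b y = 0) :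
    g ∈ convexHull ℝ (Set.range fun v => response (cubeOutcome v)) := by
  set e : Fin 4 → ℝ := fun y => g 0 y - g 1 y with he
  have hr := hid _ rectangleIdentity_mem
  have hs' : ∀ y, g 0 y + g 1 y = 1 := fun y => by simpa using hs y
  have hr' : e 0 + e 3 = e 1 + e 2 := by
    simp [rectangleIdentity, Fin.sum_univ_two, Fin.sum_univ_four] at hr
    simp only [he]
    linarith
  have hlow : ∀ y, -1 ≤ e y := fun y => by simp only [he]; linarith [hs' y, hg 0 y]
  have hupp : ∀ y, e y ≤ 1 := fun y => by simp only [he]; linarith [hs' y, hg 1 y]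
  set f : Fin 3 → ℝ := ![(e 0 + e 3) / 2, (e 0 - e 2) / 2, (e 0 - e 1) / 2] with hf
  have hf0 : f 0 = (e 0 + e 3) / 2 := rfl
  have hf1 : f 1 = (e 0 - e 2) / 2 := rfl
  have hf2 : f 2 = (e 0 - e 1) / 2 := rfl
  have hnorm : |f 0| + |f 1| + |f 2| ≤ 1 := by
    have l0 := hlow 0; have l1 := hlow 1; have l2 := hlow 2; have l3 := hlow 3
    have u0 := hupp 0; have u1 := hupp 1; have u2 := hupp 2; have u3 := hupp 3
    rw [hf0, hf1, hf2]
    rcases abs_cases ((e 0 + e 3) / 2) with ⟨h, _⟩ | ⟨h, _⟩ <;>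
    rcases abs_cases ((e 0 - e 2) / 2) with ⟨h', _⟩ | ⟨h', _⟩ <;>
    rcases abs_cases ((e 0 - e 1) / 2) with ⟨h'', _⟩ | ⟨h'', _⟩ <;>
    rw [h, h', h''] <;> linarith
  -- Positive and negative parts of `f`, plus the slack spread evenly over the six vertices, where
  -- opposite ones cancel.
  set w : Fin 3 × Fin 2 → ℝ := fun v =>
    (|f v.1| + sgn v.2 * f v.1) / 2 + (1 - (|f 0| + |f 1| + |f 2|)) / 6 with hw
  have hw0 : ∀ v, 0 ≤ w v := by
    rintro ⟨i, s⟩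
    have h1 := neg_abs_le (f i)
    have h2 := le_abs_self (f i)
    have h3 : 0 ≤ |f i| + sgn s * f i := by
      fin_cases s <;> simp <;> linarith
    simp only [hw]
    linarith
  have hw1 : ∑ v, w v = 1 := by
    simp only [hw, Fintype.sum_prod_type, Fin.sum_univ_two, Fin.sum_univ_three, sgn_zero, sgn_one]
    ring
  have hw2 : g = ∑ v, w v • response (cubeOutcome v) := by
    funext b y
    have hgy : g b y = (1 + sgn b * e y) / 2 := by
      fin_cases b <;> simp [he] <;> linarith [hs' y]
    have hey : e y = f 0 * cubeAxis y 0 + f 1 * cubeAxis y 1 + f 2 * cubeAxis y 2 := by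
      rw [hf0, hf1, hf2]
      fin_cases y <;> simp [cubeAxis] <;> linarith
    rw [hgy, hey]
    simp only [Finset.sum_apply, Pi.smul_apply, response_cube, Pi.add_apply, cubeBase, hw,
      Fintype.sum_prod_type, Fin.sum_univ_two, Fin.sum_univ_three, sgn_zero, sgn_one, smul_eq_mul]
    ring
  rw [hw2]
  exact (convex_convexHull ℝ _).sum_mem (fun v _ => hw0 v) hw1
    fun v _ => subset_convexHull ℝ _ ⟨v, rfl⟩

theorem tens_mem_octCubePolytope {f : Fin 2 → Fin 3 → ℝ} {g : Fin 2 → Fin 4 → ℝ}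
    (hf : f ∈ convexHull ℝ (Set.range (response : (Fin 3 → Fin 2) → Fin 2 → Fin 3 → ℝ)))
    (hg : g ∈ convexHull ℝ (Set.range fun v => response (cubeOutcome v))) :
    tens f g ∈ octCubePolytope := by
  have hconv : Convex ℝ octCubePolytope := convex_convexHull ℝ _
  have h1 : ∀ u : Fin 3 → Fin 2, tens (response u) g ∈ octCubePolytope := by
    intro u
    refine convexHull_min ?_ (hconv.linear_preimage (tens (response u))) hg
    rintro _ ⟨v, rfl⟩
    exact vertex_mem_polytope (u, v)
  refine convexHull_min ?_ (hconv.linear_preimage (tens.flip g)) hf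
  rintro _ ⟨u, rfl⟩
  exact h1 u

theorem exists_weights_of_mem_convexHull_range {ι E : Type} [Fintype ι] [AddCommGroup E]
    [Module ℝ E] (f : ι → E) {x : E} (hx : x ∈ convexHull ℝ (Set.range f)) :
    ∃ w : ι → ℝ, (∀ i, 0 ≤ w i) ∧ ∑ i, w i = 1 ∧ ∑ i, w i • f i = x := by
  classical
  have hsub : Set.range f ⊆ (Fintype.linearCombination ℝ f) '' stdSimplex ℝ ι := by
    rintro _ ⟨i, rfl⟩
    exact ⟨Pi.single i 1, single_mem_stdSimplex ℝ i, by simp [Fintype.linearCombination_apply]⟩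
  obtain ⟨w, hw, rfl⟩ := convexHull_min hsub ((convex_stdSimplex ℝ ι).linear_image _) hx
  exact ⟨w, hw.1, hw.2, by simp [Fintype.linearCombination_apply]⟩

/-- Each pair of ontic states contributes a product point. Conversely, weights on the vertices are a
joint distribution over deterministic assignments. -/
theorem BellScenario.NC_eq_octCubePolytope {dA dB : Type} [Fintype dA] [Fintype dB]
    [DecidableEq dA] [DecidableEq dB] (S : BellScenario (Fin 2) (Fin 2) (Fin 3) (Fin 4) dA dB)
    (hN : HasShape S.N (antipodal octahedronAxis)) (hM : HasShape S.M (antipodal cubeAxis)) :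
    S.NC .a .a .t .t = octCubePolytope := by
  ext p
  constructor
  · rintro ⟨m, n, Λ, hΛ, rfl⟩
    have hM' := (S.forall_O_respects.1 hΛ).2.1
    have hmem : ∀ k l, tens (fun a x => Λ.ξA a x k) (fun b y => Λ.ξB b y l) ∈ octCubePolytope :=
      fun k l => tens_mem_octCubePolytope
        (mem_convexHull_response (fun a x => Λ.ξA_nonneg a x k) fun x => Λ.ξA_sum x k)
        (mem_convexHull_cubeOutcome (fun b y => Λ.ξB_nonneg b y l) (fun y => Λ.ξB_sum y l)
          fun β hβ => hM' β (hM.ge hβ) l)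
    rw [Λ.stats_eq, ← Fintype.sum_prod_type']
    refine (convex_convexHull ℝ _).sum_mem (fun kl _ => Λ.μ_nonneg kl.1 kl.2) ?_
      fun kl _ => hmem kl.1 kl.2
    rw [Fintype.sum_prod_type']
    exact Λ.μ_sum
  · intro hp
    obtain ⟨w, hw0, hw1, rfl⟩ := exists_weights_of_mem_convexHull_range vertex hp
    let eA := (Fintype.equivFin (Fin 3 → Fin 2)).symm
    let eB := (Fintype.equivFin (Fin 3 × Fin 2)).symm
    have hsum : ∀ F : (Fin 3 → Fin 2) × (Fin 3 × Fin 2) → ℝ,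
        ∑ k, ∑ l, F (eA k, eB l) = ∑ v, F v := by
      intro F
      rw [Fintype.sum_prod_type, ← eA.sum_comp]
      refine Finset.sum_congr rfl fun k _ => ?_
      rw [← eB.sum_comp]
    let Λ : OntologicalModel (Fin 2) (Fin 2) (Fin 3) (Fin 4) _ _ :=
      { μ := fun k l => w (eA k, eB l)
        μ_nonneg := fun _ _ => hw0 _
        μ_sum := (hsum w).trans hw1
        ξA := fun a x k => response (eA k) a x
        ξA_nonneg := fun a x k => response_nonneg _ a x
        ξA_sum := fun x k => sum_response _ x
        ξB := fun b y l => response (cubeOutcome (eB l)) b y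
        ξB_nonneg := fun b y l => response_nonneg _ b y
        ξB_sum := fun y l => sum_response _ y }
    obtain ⟨t1, -, t3, t4⟩ := Λ.respects_trivial
    refine ⟨_, _, Λ, S.forall_O_respects.2 ⟨?_, ?_, t3, t4⟩, ?_⟩
    · intro α hα
      exact t1 α ((hN.trans vertexIdentities_octahedron).le hα)
    · intro β hβ l
      exact mem_vertexIdentities_cube.1 (hM.le hβ) (eB l)
    · funext a b x y
      rw [Finset.sum_apply, Finset.sum_apply, Finset.sum_apply, Finset.sum_apply]
      refine Eq.trans ?_ (hsum fun v => (w v • vertex v) a b x y)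
      simp only [OntologicalModel.stats, Λ, vertex, Pi.smul_apply, tens_apply, smul_eq_mul,
        mul_assoc]

/-! ### Relabelings -/

section Relabelings

variable {A B X Y : Type}

/-- The action of a relabeling on deterministic assignments. -/
def Relabeling.pull (g : Relabeling A X) (u : X → A) (x : X) : A :=
  (g.outcome x).symm (u (g.setting x))

theorem Relabeling.pull_bijective (g : Relabeling A X) : Function.Bijective g.pull := by
  constructor
  · intro u v h
    funext x
    have := congrFun h (g.setting.symm x)
    simpa [Relabeling.pull] using this
  · intro u
    refine ⟨fun x => g.outcome (g.setting.symm x) (u (g.setting.symm x)), ?_⟩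
    funext x
    simp [Relabeling.pull]

theorem Relabeling.response_apply [DecidableEq A] (g : Relabeling A X) (u : X → A) (a : A)
    (x : X) : response u (g.outcome x a) (g.setting x) = response (g.pull u) a x := by
  simp only [response, Relabeling.pull, Equiv.symm_apply_eq]

theorem Relabeling.sum_apply [Fintype A] [Fintype X] (g : Relabeling A X) (f : A → X → ℝ) :
    ∑ a, ∑ x, f (g.outcome x a) (g.setting x) = ∑ a, ∑ x, f a x := by
  rw [Finset.sum_comm, Finset.sum_comm (f := f),
    ← Equiv.sum_comp g.setting fun x => ∑ a, f a x]
  exact Finset.sum_congr rfl fun x _ => Equiv.sum_comp (g.outcome x) fun a => f a (g.setting x)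

theorem Relabeling.sum_mul_response [Fintype A] [DecidableEq A] [Fintype X] (g : Relabeling A X)
    (α : A → X → ℝ) (u : X → A) :
    ∑ a, ∑ x, α (g.outcome x a) (g.setting x) * response (g.pull u) a x =
      ∑ a, ∑ x, α a x * response u a x := by
  simp only [← g.response_apply]
  exact g.sum_apply fun a x => α a x * response u a x

/-- `relabel` as a linear map. -/
def relabelLinear (g : Relabeling A X) (h : Relabeling B Y) : Stats A B X Y →ₗ[ℝ] Stats A B X Y where
  toFun := relabel g h
  map_add' _ _ := rfl
  map_smul' _ _ := rfl

theorem relabelLinear_injective (g : Relabeling A X) (h : Relabeling B Y) :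
    Function.Injective (relabelLinear g h) := by
  intro p q hpq
  change relabel g h p = relabel g h q at hpq
  funext a b x y
  have := congrFun (congrFun (congrFun (congrFun hpq ((g.outcome (g.setting.symm x)).symm a))
    ((h.outcome (h.setting.symm y)).symm b)) (g.setting.symm x)) (h.setting.symm y)
  simpa [relabel] using this

theorem relabelLinear_tens [DecidableEq A] [DecidableEq B] (g : Relabeling A X)
    (h : Relabeling B Y) (u : X → A) (v : Y → B) :
    relabelLinear g h (tens (response u) (response v)) =
      tens (response (g.pull u)) (response (h.pull v)) := by
  funext a b x y
  change response u (g.outcome x a) (g.setting x) * response v (h.outcome y b) (h.setting y) = _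
  rw [g.response_apply, h.response_apply, tens_apply]

end Relabelings

/-- Trivial identities have coefficients independent of the outcome, so every relabeling preserves
them. -/
theorem Relabeling.isSymmetry_octahedron {d : Type} [Fintype d] {N : Fin 2 → Fin 3 → Matrix d d ℂ}
    (hN : HasShape N (antipodal octahedronAxis)) (g : Relabeling (Fin 2) (Fin 3)) :
    g.IsSymmetry N := by
  intro α
  rw [hN.trans vertexIdentities_octahedron, mem_trivialIdentities, mem_trivialIdentities]
  constructor
  · rintro ⟨c, hc, h⟩
    refine ⟨fun x => c (g.setting.symm x), by rw [Equiv.sum_comp g.setting.symm, hc], ?_⟩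
    funext a x
    have := congrFun (congrFun h ((g.outcome (g.setting.symm x)).symm a)) (g.setting.symm x)
    simpa using this
  · rintro ⟨c, hc, rfl⟩
    exact ⟨fun x => c (g.setting x), by rw [Equiv.sum_comp g.setting, hc], rfl⟩

theorem cubeOutcome_injective : Function.Injective cubeOutcome := by
  have : ∀ v v', (∀ y, cubeOutcome v y = cubeOutcome v' y) → v = v' := by decide
  exact fun v v' h => this v v' (congrFun h)

theorem exists_cubeOutcome_eq {ω : Fin 4 → Fin 2}
    (h : ∑ b, ∑ y, rectangleIdentity b y * response ω b y = 0) : ∃ v, ω = cubeOutcome v := by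
  have key : ∀ a b c d : Fin 2, sgn a - sgn b - sgn c + sgn d = 0 →
      a = b ∧ c = d ∨ a = c ∧ b = d := by
    intro a b c d
    fin_cases a <;> fin_cases b <;> fin_cases c <;> fin_cases d <;> norm_num
  have h1 : ω 0 = ω 1 ∧ ω 2 = ω 3 ∨ ω 0 = ω 2 ∧ ω 1 = ω 3 := by
    apply key
    rw [← h, Finset.sum_comm]
    simp [rectangleIdentity, Fin.sum_univ_two, Fin.sum_univ_four, response, ite_eq_sgn]
    ring
  have h2 : ∀ ω : Fin 4 → Fin 2, (ω 0 = ω 1 ∧ ω 2 = ω 3 ∨ ω 0 = ω 2 ∧ ω 1 = ω 3) →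
      ∃ v, ∀ y, ω y = cubeOutcome v y := by decide
  obtain ⟨v, hv⟩ := h2 ω h1
  exact ⟨v, funext hv⟩

theorem perm_two_symm_apply (π : Equiv.Perm (Fin 2)) (b : Fin 2) : π.symm b = b + π 0 := by
  revert π b; decide

/-- The symmetries of the cube act on its responses by signed permutations of the coordinates. -/
def Relabeling.ActsBy (h : Relabeling (Fin 2) (Fin 4)) (κ : Equiv.Perm (Fin 3))
    (δ : Fin 3 → Fin 2) : Prop :=
  ∀ i s, h.pull (cubeOutcome (i, s)) = cubeOutcome (κ i, δ i + s)

/-- Transporting the rectangle identity shows that the pulled-back assignment satisfies it, which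
leaves only the six `cubeOutcome`s. Permutations of bits are translations, so `s` is carried along
additively. -/
theorem Relabeling.IsSymmetry.exists_actsBy {d : Type} [Fintype d]
    {M : Fin 2 → Fin 4 → Matrix d d ℂ} (hM : HasShape M (antipodal cubeAxis))
    {h : Relabeling (Fin 2) (Fin 4)} (hh : h.IsSymmetry M) : ∃ κ δ, h.ActsBy κ δ := by
  have h1 : ∀ i, ∃ v, h.pull (cubeOutcome (i, 0)) = cubeOutcome v := by
    intro i
    apply exists_cubeOutcome_eq
    set β : Fin 2 → Fin 4 → ℝ := fun b y =>
      rectangleIdentity ((h.outcome (h.setting.symm y)).symm b) (h.setting.symm y) with hβ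
    have hβ' : (fun b y => β (h.outcome y b) (h.setting y)) = rectangleIdentity := by
      funext b y
      simp [hβ]
    have hmem : β ∈ vertexIdentities (antipodal cubeAxis) := by
      have := (hh β).1 (by rw [hβ']; exact hM.ge rectangleIdentity_mem)
      exact hM.le this
    have := h.sum_mul_response β (cubeOutcome (i, 0))
    rw [mem_vertexIdentities_cube.1 hmem] at this
    rw [← this]
    exact Finset.sum_congr rfl fun b _ => Finset.sum_congr rfl fun y _ => by
      rw [← congrFun (congrFun hβ' b) y]
  choose η hη using h1
  have h2 : ∀ i s, h.pull (cubeOutcome (i, s)) = cubeOutcome ((η i).1, (η i).2 + s) := by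
    intro i s
    funext y
    have := congrFun (hη i) y
    simp only [Relabeling.pull, perm_two_symm_apply, cubeOutcome, zero_add] at this ⊢
    rw [add_right_comm (η i).2, ← this]
    abel
  have hinj : Function.Injective fun i => (η i).1 := by
    intro i k hik
    have h3 : h.pull (cubeOutcome (i, 0)) = h.pull (cubeOutcome (k, (η k).2 + (η i).2)) := by
      have bit : ∀ a b : Fin 2, a + (a + b) = b := by decide
      rw [hη, h2, bit]
      exact congrArg cubeOutcome (Prod.ext hik rfl)
    exact congrArg Prod.fst (cubeOutcome_injective (h.pull_bijective.1 h3))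
  exact ⟨Equiv.ofBijective _ (Finite.injective_iff_bijective.1 hinj), fun i => (η i).2, h2⟩

theorem Relabeling.ActsBy.isSymmetry {d : Type} [Fintype d]
    {M : Fin 2 → Fin 4 → Matrix d d ℂ} (hM : HasShape M (antipodal cubeAxis))
    {h : Relabeling (Fin 2) (Fin 4)} {κ : Equiv.Perm (Fin 3)} {δ : Fin 3 → Fin 2}
    (hh : h.ActsBy κ δ) : h.IsSymmetry M := by
  intro β
  rw [show allIdentities M = _ from hM, mem_vertexIdentities_cube, mem_vertexIdentities_cube]
  have key : ∀ i s, ∑ b, ∑ y, β (h.outcome y b) (h.setting y) *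
      response (cubeOutcome (κ i, δ i + s)) b y =
      ∑ b, ∑ y, β b y * response (cubeOutcome (i, s)) b y := fun i s => by
    rw [← hh i s, h.sum_mul_response]
  constructor
  · rintro H ⟨i, s⟩
    rw [← key]
    exact H _
  · rintro H ⟨i, s⟩
    have := (key (κ.symm i) (δ (κ.symm i) + s)).trans (H _)
    have bit : ∀ a b : Fin 2, a + (a + b) = b := by decide
    rwa [κ.apply_symm_apply, bit] at this

theorem exists_actsBy (κ : Equiv.Perm (Fin 3)) (δ : Fin 3 → Fin 2) :
    ∃ h : Relabeling (Fin 2) (Fin 4), h.ActsBy κ δ := by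
  -- Each diagonal is represented by its vertex with first bit 0. `ε` is the flip restoring this
  -- convention after the signed permutation, and the table in `f` inverts `cubeBit` on the other
  -- two bits.
  let ε : Fin 4 → Fin 2 := fun y => δ 0 + cubeBit y (κ 0)
  let f : Fin 4 → Fin 4 := fun y =>
    ![![0, 1], ![2, 3]] (ε y + δ 1 + cubeBit y (κ 1)) (ε y + δ 2 + cubeBit y (κ 2))
  have hinj : Function.Injective f := by
    simp only [f, ε]
    clear f ε
    revert κ δ
    decide +kernel
  have hf : ∀ i y, cubeBit (f y) i + ε y = δ i + cubeBit y (κ i) := by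
    simp only [f, ε]
    clear hinj f ε
    revert κ δ
    decide +kernel
  refine ⟨⟨Equiv.ofBijective f (Finite.injective_iff_bijective.1 hinj),
    fun y => Equiv.addRight (ε y)⟩, fun i s => ?_⟩
  funext y
  simp only [Relabeling.pull, perm_two_symm_apply, cubeOutcome, Equiv.ofBijective_apply,
    Equiv.coe_addRight, zero_add]
  rw [add_right_comm, add_assoc, add_comm (ε y), hf]
  abel

/-! ### The classes of the facets -/

/-- The action of symmetries of the octahedron and the cube on the labels of the facets. -/
def relabelLiterals (g : Relabeling (Fin 2) (Fin 3)) (κ : Equiv.Perm (Fin 3)) (δ : Fin 3 → Fin 2)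
    (τ : Fin 3 → Literal) (i : Fin 3) : Literal :=
  ((τ (κ i)).1.map g.setting, (τ (κ i)).2 + δ i + (τ (κ i)).1.elim 0 fun j => g.outcome j 0)

theorem eval_relabelLiterals (g : Relabeling (Fin 2) (Fin 3)) (κ : Equiv.Perm (Fin 3))
    (δ : Fin 3 → Fin 2) (τ : Fin 3 → Literal) (i : Fin 3) (u : Fin 3 → Fin 2) :
    (relabelLiterals g κ δ τ i).eval u = (τ (κ i)).eval (g.pull u) + δ i := by
  simp only [relabelLiterals, Literal.eval]
  rcases (τ (κ i)).1 with _ | j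
  · simp
  · simp only [Option.map_some, Option.elim, Relabeling.pull, perm_two_symm_apply]
    abel

theorem relabelLinear_vertex {g : Relabeling (Fin 2) (Fin 3)} {h : Relabeling (Fin 2) (Fin 4)}
    {κ : Equiv.Perm (Fin 3)} {δ : Fin 3 → Fin 2} (hh : h.ActsBy κ δ) (u : Fin 3 → Fin 2)
    (i : Fin 3) (s : Fin 2) :
    relabelLinear g h (vertex (u, i, s)) = vertex (g.pull u, κ i, δ i + s) := by
  rw [vertex, relabelLinear_tens, hh i s, vertex]

theorem relabelLinear_image_polytope {g : Relabeling (Fin 2) (Fin 3)}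
    {h : Relabeling (Fin 2) (Fin 4)} {κ : Equiv.Perm (Fin 3)} {δ : Fin 3 → Fin 2}
    (hh : h.ActsBy κ δ) : relabelLinear g h '' octCubePolytope = octCubePolytope := by
  have bit : ∀ a b : Fin 2, a + (a + b) = b := by decide
  rw [octCubePolytope, LinearMap.image_convexHull]
  congr 1
  ext p
  constructor
  · rintro ⟨_, ⟨⟨u, i, s⟩, rfl⟩, rfl⟩
    exact ⟨_, (relabelLinear_vertex hh u i s).symm⟩
  · rintro ⟨⟨u, i, s⟩, rfl⟩
    obtain ⟨u', rfl⟩ := g.pull_bijective.2 u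
    refine ⟨_, ⟨(u', κ.symm i, δ (κ.symm i) + s), rfl⟩, ?_⟩
    rw [relabelLinear_vertex hh, κ.apply_symm_apply, bit]

theorem preimage_facetOf (g : Relabeling (Fin 2) (Fin 3)) {h : Relabeling (Fin 2) (Fin 4)}
    {κ : Equiv.Perm (Fin 3)} {δ : Fin 3 → Fin 2} (hh : h.ActsBy κ δ) (τ : Fin 3 → Literal) :
    relabel g h ⁻¹' facetOf τ = facetOf (relabelLiterals g κ δ τ) := by
  have hP : ∀ p, relabelLinear g h p ∈ octCubePolytope ↔ p ∈ octCubePolytope := by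
    intro p
    rw [← relabelLinear_image_polytope (g := g) hh]
    rw [(relabelLinear_injective g h).mem_set_image, relabelLinear_image_polytope hh]
  have hφ : ∀ p ∈ octCubePolytope,
      facetForm τ (relabelLinear g h p) = facetForm (relabelLiterals g κ δ τ) p := by
    intro p hp
    have := (convexHull_zero_imp_zero (V := Set.range vertex) (φ := 0)
      (ψ := facetForm τ ∘ₗ relabelLinear g h - facetForm (relabelLiterals g κ δ τ)) (by simp) (by
        rintro _ ⟨⟨u, i, s⟩, rfl⟩ _
        rw [LinearMap.sub_apply, LinearMap.comp_apply, relabelLinear_vertex hh, facetForm_vertex,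
          facetForm_vertex, eval_relabelLiterals, add_assoc, sub_self]) p hp).2 rfl
    exact sub_eq_zero.1 this
  ext p
  change (relabelLinear g h p ∈ octCubePolytope ∧ facetForm τ (relabelLinear g h p) = 0) ↔
    (p ∈ octCubePolytope ∧ _)
  rw [hP]
  exact and_congr_right fun hp => by rw [hφ p hp]

/-- The settings occurring in `τ` and `τ'` agree up to permutations. -/
def SamePattern (τ τ' : Fin 3 → Literal) : Prop :=
  ∃ κ π : Equiv.Perm (Fin 3), ∀ i, (τ' i).1 = (τ (κ i)).1.map π

/-- The bits of the labels drop out because `δ` shifts each literal independently, even with the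
first party's outcomes fixed. -/
theorem BellScenario.faceClass_facetOf {dA dB : Type} [Fintype dA] [Fintype dB]
    [DecidableEq dA] [DecidableEq dB] (S : BellScenario (Fin 2) (Fin 2) (Fin 3) (Fin 4) dA dB)
    (hN : HasShape S.N (antipodal octahedronAxis)) (hM : HasShape S.M (antipodal cubeAxis))
    (τ : Fin 3 → Literal) : S.faceClass (facetOf τ) = facetOf '' {τ' | SamePattern τ τ'} := by
  ext F
  constructor
  · rintro ⟨g, h, -, hh, rfl⟩
    obtain ⟨κ, δ, hact⟩ := hh.exists_actsBy hM
    exact ⟨_, ⟨κ, g.setting, fun i => rfl⟩, (preimage_facetOf g hact τ).symm⟩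
  · rintro ⟨τ', ⟨κ, π, hτ'⟩, rfl⟩
    obtain ⟨h, hact⟩ := exists_actsBy κ fun i => (τ (κ i)).2 + (τ' i).2
    let g : Relabeling (Fin 2) (Fin 3) := ⟨π, fun _ => 1⟩
    refine ⟨g, h, g.isSymmetry_octahedron hN, hact.isSymmetry hM, ?_⟩
    rw [preimage_facetOf g hact]
    congr 1
    funext i
    have bit : ∀ a b : Fin 2, a + (a + b) = b := by decide
    refine Prod.ext (hτ' i) ?_
    simp only [relabelLiterals, bit, g]
    rcases (τ (κ i)).1 with _ | j <;> simp

/-! ### The three inequalities as facet functionals -/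

/-- The label of the facet of the first inequality. -/
def label₁ : Fin 3 → Literal := ![(some 0, 0), (some 2, 1), (some 2, 0)]

/-- The label of the facet of the second inequality. -/
def label₂ : Fin 3 → Literal := ![(some 0, 0), (some 2, 1), (none, 0)]

/-- The label of the facet of the third inequality. -/
def label₃ : Fin 3 → Literal := ![(some 0, 0), (some 1, 1), (some 2, 0)]

/-- Agreement at the 48 vertices gives agreement on the hull, although the functionals need not
coincide on all statistics. -/
theorem eq_facetForm {f : Stats (Fin 2) (Fin 2) (Fin 3) (Fin 4) → ℝ} (τ : Fin 3 → Literal)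
    (hf : ∀ (p q : Stats (Fin 2) (Fin 2) (Fin 3) (Fin 4)) (r s : ℝ),
      f (r • p + s • q) = r * f p + s * f q)
    (hv : ∀ w, f (vertex w) = facetForm τ (vertex w)) {p : Stats (Fin 2) (Fin 2) (Fin 3) (Fin 4)}
    (hp : p ∈ octCubePolytope) : f p = facetForm τ p := by
  have hconv : Convex ℝ {p | f p = facetForm τ p} := by
    intro x hx y hy a b _ _ _
    change f x = _ at hx
    change f y = _ at hy
    change f (a • x + b • y) = _
    rw [hf, hx, hy, map_add, map_smul, map_smul, smul_eq_mul, smul_eq_mul]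
  have hsub : Set.range vertex ⊆ {p | f p = facetForm τ p} := by
    rintro _ ⟨w, rfl⟩
    exact hv w
  exact convexHull_min hsub hconv hp

theorem ineq₁_eq {p : Stats (Fin 2) (Fin 2) (Fin 3) (Fin 4)} (hp : p ∈ octCubePolytope) :
    ineq₁ p = facetForm label₁ p := by
  refine eq_facetForm label₁ (fun p q r s => ?_) ?_ hp
  · simp only [ineq₁, Pi.add_apply, Pi.smul_apply, smul_eq_mul]
    ring
  · rintro ⟨u, v⟩
    simp only [ineq₁, vertex_apply, facetForm_vertex]
    have : ∀ (u : Fin 3 → Fin 2) (v : Fin 3 × Fin 2),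
        (if u 2 = 0 ∧ cubeOutcome v 2 = 1 then (1 : ℤ) else 0) +
        (if u 0 = 1 ∧ cubeOutcome v 3 = 0 then 1 else 0) -
        (if u 0 = 1 ∧ cubeOutcome v 0 = 1 then 1 else 0) +
        (if u 2 = 1 ∧ cubeOutcome v 1 = 1 then 1 else 0) =
        if (label₁ v.1).eval u + v.2 = 0 then 0 else 1 := by decide +kernel
    exact_mod_cast this u v

theorem ineq₂_eq {p : Stats (Fin 2) (Fin 2) (Fin 3) (Fin 4)} (hp : p ∈ octCubePolytope) :
    ineq₂ p = facetForm label₂ p := by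
  refine eq_facetForm label₂ (fun p q r s => ?_) ?_ hp
  · simp only [ineq₂, Pi.add_apply, Pi.smul_apply, smul_eq_mul]
    ring
  · rintro ⟨u, v⟩
    simp only [ineq₂, vertex_apply, facetForm_vertex]
    have : ∀ (u : Fin 3 → Fin 2) (v : Fin 3 × Fin 2),
        (if u 2 = 0 ∧ cubeOutcome v 2 = 1 then (1 : ℤ) else 0) +
        (if u 0 = 1 ∧ cubeOutcome v 3 = 0 then 1 else 0) -
        (if u 0 = 1 ∧ cubeOutcome v 0 = 1 then 1 else 0) +
        (if u 2 = 1 ∧ cubeOutcome v 0 = 1 then 1 else 0) =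
        if (label₂ v.1).eval u + v.2 = 0 then 0 else 1 := by decide +kernel
    exact_mod_cast this u v

theorem ineq₃_eq {p : Stats (Fin 2) (Fin 2) (Fin 3) (Fin 4)} (hp : p ∈ octCubePolytope) :
    ineq₃ p = facetForm label₃ p := by
  refine eq_facetForm label₃ (fun p q r s => ?_) ?_ hp
  · simp only [ineq₃, Pi.add_apply, Pi.smul_apply, smul_eq_mul]
    ring
  · rintro ⟨u, v⟩
    simp only [ineq₃, vertex_apply, facetForm_vertex]
    have : ∀ (u : Fin 3 → Fin 2) (v : Fin 3 × Fin 2),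
        (if u 2 = 0 ∧ cubeOutcome v 2 = 1 then (1 : ℤ) else 0) +
        (if u 0 = 1 ∧ cubeOutcome v 3 = 0 then 1 else 0) -
        (if u 0 = 1 ∧ cubeOutcome v 0 = 1 then 1 else 0) +
        (if u 1 = 1 ∧ cubeOutcome v 0 = 1 then 1 else 0) -
        (if u 1 = 1 ∧ cubeOutcome v 2 = 1 then 1 else 0) -
        (if u 2 = 1 ∧ cubeOutcome v 0 = 1 then 1 else 0) +
        (if u 2 = 1 ∧ cubeOutcome v 1 = 1 then 1 else 0) +
        (if u 2 = 1 ∧ cubeOutcome v 2 = 1 then 1 else 0) =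
        if (label₃ v.1).eval u + v.2 = 0 then 0 else 1 := by decide +kernel
    exact_mod_cast this u v

theorem setOf_ineq_eq {f : Stats (Fin 2) (Fin 2) (Fin 3) (Fin 4) → ℝ} {τ : Fin 3 → Literal}
    (h : ∀ p ∈ octCubePolytope, f p = facetForm τ p) :
    {p ∈ octCubePolytope | f p = 0} = facetOf τ := by
  ext p
  exact and_congr_right fun hp => by rw [h p hp]

/-! ### Counting labels by axis pattern -/

/-- No constant occurs, and exactly two settings occur. -/
def RepeatedAxis (o : Fin 3 → Option (Fin 3)) : Prop :=
  (∀ i, o i ≠ none) ∧ (∃ i k, o i ≠ o k) ∧ ∃ i k, i ≠ k ∧ o i = o k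

/-- A constant and two settings occur. -/
def ConstantAxis (o : Fin 3 → Option (Fin 3)) : Prop :=
  (∃ i, o i = none) ∧ ∃ i k, o i ≠ none ∧ o k ≠ none ∧ o i ≠ o k

/-- All three settings occur. -/
def DistinctAxes (o : Fin 3 → Option (Fin 3)) : Prop :=
  (∀ i, o i ≠ none) ∧ ∀ i k, o i = o k → i = k

instance : DecidablePred RepeatedAxis := fun o => by unfold RepeatedAxis; infer_instance

instance : DecidablePred ConstantAxis := fun o => by unfold ConstantAxis; infer_instance

instance : DecidablePred DistinctAxes := fun o => by unfold DistinctAxes; infer_instance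

/-- Bits play no role, so the finite check runs over the 4³ axis patterns instead of all labels. -/
theorem samePattern_iff {τ : Fin 3 → Literal} {C : (Fin 3 → Option (Fin 3)) → Prop}
    (h₁ : ∀ κ π : Equiv.Perm (Fin 3), C fun i => (τ (κ i)).1.map π)
    (h₂ : ∀ o, C o → ∃ κ π : Equiv.Perm (Fin 3), ∀ i, o i = (τ (κ i)).1.map π)
    (τ' : Fin 3 → Literal) : SamePattern τ τ' ↔ C fun i => (τ' i).1 := by
  constructor
  · rintro ⟨κ, π, h⟩
    rw [funext h]
    exact h₁ κ π
  · exact h₂ _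

theorem samePattern_label₁ (τ : Fin 3 → Literal) :
    SamePattern label₁ τ ↔ RepeatedAxis fun i => (τ i).1 :=
  samePattern_iff (by decide +kernel) (by decide +kernel) τ

theorem samePattern_label₂ (τ : Fin 3 → Literal) :
    SamePattern label₂ τ ↔ ConstantAxis fun i => (τ i).1 :=
  samePattern_iff (by decide +kernel) (by decide +kernel) τ

theorem samePattern_label₃ (τ : Fin 3 → Literal) :
    SamePattern label₃ τ ↔ DistinctAxes fun i => (τ i).1 :=
  samePattern_iff (by decide +kernel) (by decide +kernel) τ

theorem twoAxes_iff (τ : Fin 3 → Literal) :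
    TwoAxes τ ↔ SamePattern label₁ τ ∨ SamePattern label₂ τ ∨ SamePattern label₃ τ := by
  rw [samePattern_label₁, samePattern_label₂, samePattern_label₃]
  have h : ∀ o : Fin 3 → Option (Fin 3), (∃ i k, o i ≠ none ∧ o k ≠ none ∧ o i ≠ o k) ↔
      RepeatedAxis o ∨ ConstantAxis o ∨ DistinctAxes o := by decide +kernel
  exact h _

theorem not_samePattern₁₂ (τ : Fin 3 → Literal) :
    ¬(SamePattern label₁ τ ∧ SamePattern label₂ τ) := by
  rw [samePattern_label₁, samePattern_label₂]
  rintro ⟨h, ⟨i, hi⟩, -⟩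
  exact h.1 i hi

theorem not_samePattern₁₃ (τ : Fin 3 → Literal) :
    ¬(SamePattern label₁ τ ∧ SamePattern label₃ τ) := by
  rw [samePattern_label₁, samePattern_label₃]
  rintro ⟨⟨-, -, i, k, hne, h⟩, h'⟩
  exact hne (h'.2 i k h)

theorem not_samePattern₂₃ (τ : Fin 3 → Literal) :
    ¬(SamePattern label₂ τ ∧ SamePattern label₃ τ) := by
  rw [samePattern_label₂, samePattern_label₃]
  rintro ⟨⟨⟨i, hi⟩, -⟩, h⟩
  exact h.1 i hi

theorem disjoint_image_facetOf {s t : Set (Fin 3 → Literal)} (h : ∀ τ, ¬(τ ∈ s ∧ τ ∈ t)) :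
    Disjoint (facetOf '' s) (facetOf '' t) := by
  rw [Set.disjoint_image_iff facetOf_injective, Set.disjoint_left]
  exact fun τ hs ht => h τ ⟨hs, ht⟩

theorem ncard_image_facetOf (s : (Fin 3 → Literal) → Prop) [DecidablePred s] :
    (facetOf '' {τ | s τ}).ncard = (Finset.univ.filter s).card := by
  rw [Set.ncard_image_of_injective _ facetOf_injective, Set.ncard_eq_toFinset_card',
    Set.toFinset_ofPred]

theorem ncard_class₁ : (facetOf '' {τ | SamePattern label₁ τ}).ncard = 144 := by
  simp only [samePattern_label₁]
  rw [ncard_image_facetOf]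
  decide +kernel

theorem ncard_class₂ : (facetOf '' {τ | SamePattern label₂ τ}).ncard = 144 := by
  simp only [samePattern_label₂]
  rw [ncard_image_facetOf]
  decide +kernel

theorem ncard_class₃ : (facetOf '' {τ | SamePattern label₃ τ}).ncard = 48 := by
  simp only [samePattern_label₃]
  rw [ncard_image_facetOf]
  decide +kernel

/-! ### Qubit measurements on isotropic states -/

/-- The identity and the Pauli matrices are linearly independent, so an operator identity splits
into its scalar and Bloch-vector parts. The common scale `r` is harmless, which covers the factor `1
/ √3`. -/
theorem hasShape_qubitEffect {X : Type} [Fintype X] (m : X → Fin 3 → ℝ) {r : ℝ} (hr : r ≠ 0) :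
    HasShape (qubitEffect fun x => r • m x) (antipodal m) := by
  ext α
  set M := ∑ a, ∑ x, α a x • qubitEffect (fun x => r • m x) a x with hM
  set s := ∑ a, ∑ x, α a x with hs
  set v : Fin 3 → ℝ := fun i => ∑ a, ∑ x, α a x * (sgn a * m x i) with hv
  have hentry : ∀ i j, M i j = ∑ a, ∑ x, α a x • qubitEffect (fun x => r • m x) a x i j := by
    intro i j
    simp only [hM, Matrix.sum_apply, Matrix.smul_apply]
  have h00 : M 0 0 = (((s + r * v 2) / 2 : ℝ) : ℂ) := by
    rw [hentry, hs, hv]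
    simp only [Finset.mul_sum, ← Finset.sum_add_distrib, Finset.sum_div, Complex.ofReal_sum]
    refine Finset.sum_congr rfl fun a _ => Finset.sum_congr rfl fun x _ => ?_
    simp [qubitEffect, pauliDot, sgn]
    ring
  have h11 : M 1 1 = (((s - r * v 2) / 2 : ℝ) : ℂ) := by
    rw [hentry, hs, hv]
    simp only [Finset.mul_sum, ← Finset.sum_sub_distrib, Finset.sum_div, Complex.ofReal_sum]
    refine Finset.sum_congr rfl fun a _ => Finset.sum_congr rfl fun x _ => ?_
    simp [qubitEffect, pauliDot, sgn]
    ring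
  have h01 : M 0 1 = ((r * v 0 / 2 : ℝ) : ℂ) - ((r * v 1 / 2 : ℝ) : ℂ) * Complex.I := by
    rw [hentry, hv]
    simp only [Finset.mul_sum, Finset.sum_div, Complex.ofReal_sum, Finset.sum_mul,
      ← Finset.sum_sub_distrib]
    refine Finset.sum_congr rfl fun a _ => Finset.sum_congr rfl fun x _ => ?_
    simp [qubitEffect, pauliDot, sgn]
    ring
  have h10 : M 1 0 = ((r * v 0 / 2 : ℝ) : ℂ) + ((r * v 1 / 2 : ℝ) : ℂ) * Complex.I := by
    rw [hentry, hv]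
    simp only [Finset.mul_sum, Finset.sum_div, Complex.ofReal_sum, Finset.sum_mul,
      ← Finset.sum_add_distrib]
    refine Finset.sum_congr rfl fun a _ => Finset.sum_congr rfl fun x _ => ?_
    simp [qubitEffect, pauliDot, sgn]
    ring
  change M = 0 ↔ (s = 0 ∧ _)
  have hvec : (∑ a, ∑ x, α a x • antipodal m a x) = v :=
    funext fun i => sum_smul_antipodal α m i
  rw [hvec]
  constructor
  · intro h
    rw [h, Matrix.zero_apply, eq_comm] at h00 h11 h01
    rw [Complex.ofReal_eq_zero] at h00 h11
    have hre := congrArg Complex.re h01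
    have him := congrArg Complex.im h01
    simp [hr] at hre him
    have h2 : r * v 2 = 0 := by linarith
    refine ⟨by linarith, funext fun i => ?_⟩
    rcases three_cases i with rfl | rfl | rfl
    · exact hre
    · exact him
    · exact (mul_eq_zero.1 h2).resolve_left hr
  · rintro ⟨h0, h1⟩
    ext i j
    fin_cases i <;> fin_cases j
    · simpa [h0, h1] using h00
    · simpa [h0, h1] using h01
    · simpa [h0, h1] using h10
    · simpa [h0, h1] using h11

/-- The minus sign is the anticorrelation of `σ_y ⊗ σ_y` in `Φ⁺`. -/
theorem trace_isotropic_mul (p : ℝ) {X Y : Type} (m : X → Fin 3 → ℝ) (n : Y → Fin 3 → ℝ)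
    (a b : Fin 2) (x : X) (y : Y) :
    ((isotropic p * (qubitEffect m a x ⊗ₖ qubitEffect n b y)).trace).re =
      (1 + p * (sgn a * sgn b) * (m x 0 * n y 0 - m x 1 * n y 1 + m x 2 * n y 2)) / 4 := by
  have h : (((Real.sqrt 2 : ℝ) : ℂ))⁻¹ * ((Real.sqrt 2 : ℝ) : ℂ)⁻¹ = 1 / 2 := by
    rw [← mul_inv, ← Complex.ofReal_mul, Real.mul_self_sqrt (by norm_num)]
    norm_num
  have key : (isotropic p * (qubitEffect m a x ⊗ₖ qubitEffect n b y)).trace =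
      (((1 + p * (sgn a * sgn b) * (m x 0 * n y 0 - m x 1 * n y 1 + m x 2 * n y 2)) / 4 : ℝ) :
        ℂ) := by
    simp [isotropic, Matrix.trace, Matrix.mul_apply, Fintype.sum_prod_type, Fin.sum_univ_two,
      Matrix.vecMulVec_apply, phiPlus, qubitEffect, pauliDot, Matrix.one_apply, h]
    simp only [sgn, Complex.ofReal_pow, Complex.ofReal_neg, Complex.ofReal_one]
    ring_nf
    simp only [Complex.I_sq]
    ring
  rw [key, Complex.ofReal_re]

theorem octCubeScenario_hasShape_left (p : ℝ) (hp : p ∈ Set.Icc (0 : ℝ) 1) :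
    HasShape (octCubeScenario p hp).N (antipodal octahedronAxis) := by
  have := hasShape_qubitEffect octahedronAxis one_ne_zero
  simp only [one_smul] at this
  exact this

theorem octCubeScenario_hasShape_right (p : ℝ) (hp : p ∈ Set.Icc (0 : ℝ) 1) :
    HasShape (octCubeScenario p hp).M (antipodal cubeAxis) :=
  hasShape_qubitEffect cubeAxis (by positivity)

/-- `label₃` pairs axis `i` with coordinate `i` with signs +, −, +, exactly those of the `Φ⁺`
correlations, so all three terms add up. -/
theorem ineq₃_octCubeScenario (p : ℝ) (hp : p ∈ Set.Icc (0 : ℝ) 1) :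
    ineq₃ (octCubeScenario p hp).stats = (1 - 3 * (1 / Real.sqrt 3) * p) / 2 := by
  have h : ∀ a b x y, (octCubeScenario p hp).stats a b x y =
      (1 + p * (sgn a * sgn b) * (octahedronAxis x 0 * (1 / Real.sqrt 3 * cubeAxis y 0) -
        octahedronAxis x 1 * (1 / Real.sqrt 3 * cubeAxis y 1) +
        octahedronAxis x 2 * (1 / Real.sqrt 3 * cubeAxis y 2))) / 4 := fun a b x y =>
    trace_isotropic_mul p octahedronAxis (fun y => (1 / Real.sqrt 3) • cubeAxis y) a b x y
  simp only [ineq₃, h, cubeAxis_table, octahedronAxis, sgn_zero, sgn_one]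
  simp
  ring

theorem ineq₃_octCubeScenario_neg_iff (p : ℝ) (hp : p ∈ Set.Icc (0 : ℝ) 1) :
    ineq₃ (octCubeScenario p hp).stats < 0 ↔ 1 / Real.sqrt 3 < p := by
  rw [ineq₃_octCubeScenario]
  have hr : 0 < 1 / Real.sqrt 3 := by positivity
  have hr2 : 3 * (1 / Real.sqrt 3) * (1 / Real.sqrt 3) = 1 := by
    rw [mul_assoc, div_mul_div_comm, Real.mul_self_sqrt (by norm_num)]
    norm_num
  set r := 1 / Real.sqrt 3
  constructor
  · intro h
    by_contra hle
    nlinarith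
  · intro h
    nlinarith

end NCBell

theorem mainTheorem3 :
    (∀ (dA dB : Type) [Fintype dA] [Fintype dB] [DecidableEq dA] [DecidableEq dB]
      (S : BellScenario (Fin 2) (Fin 2) (Fin 3) (Fin 4) dA dB),
      HasShape S.N (antipodal octahedronAxis) → HasShape S.M (antipodal cubeAxis) →
      -- the hierarchy of sets of operational identities
      (S.O .a .a .t .t = S.O .t .a .t .t ∧ S.O .a .t .t .t ⊂ S.O .t .a .t .t ∧
        S.O .a .t .t .t = S.O .t .t .t .t) ∧
      -- the hierarchy of sets of correlations
      (S.NC .a .a .t .t = S.NC .t .a .t .t ∧ S.NC .t .a .t .t ⊂ S.NC .a .t .t .t ∧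
        S.NC .a .t .t .t = S.NC .t .t .t .t) ∧
      -- the polytope and its dimension
      (∃ V : Set (Stats (Fin 2) (Fin 2) (Fin 3) (Fin 4)),
        V.Finite ∧ S.NC .a .a .t .t = convexHull ℝ V) ∧
      affDim (S.NC .a .a .t .t) = 15 ∧
      -- the nontrivial facets
      (nontrivialFacets (S.NC .a .a .t .t)).ncard = 336 ∧
      -- the three inequalities are valid and define nontrivial facets
      (∀ p ∈ S.NC .a .a .t .t, 0 ≤ ineq₁ p ∧ 0 ≤ ineq₂ p ∧ 0 ≤ ineq₃ p) ∧
      {p ∈ S.NC .a .a .t .t | ineq₁ p = 0} ∈ nontrivialFacets (S.NC .a .a .t .t) ∧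
      {p ∈ S.NC .a .a .t .t | ineq₂ p = 0} ∈ nontrivialFacets (S.NC .a .a .t .t) ∧
      {p ∈ S.NC .a .a .t .t | ineq₃ p = 0} ∈ nontrivialFacets (S.NC .a .a .t .t) ∧
      -- their classes are distinct, have the stated sizes, and exhaust the nontrivial facets
      nontrivialFacets (S.NC .a .a .t .t) =
        S.faceClass {p ∈ S.NC .a .a .t .t | ineq₁ p = 0} ∪
        S.faceClass {p ∈ S.NC .a .a .t .t | ineq₂ p = 0} ∪
        S.faceClass {p ∈ S.NC .a .a .t .t | ineq₃ p = 0} ∧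
      Disjoint (S.faceClass {p ∈ S.NC .a .a .t .t | ineq₁ p = 0})
        (S.faceClass {p ∈ S.NC .a .a .t .t | ineq₂ p = 0}) ∧
      Disjoint (S.faceClass {p ∈ S.NC .a .a .t .t | ineq₁ p = 0})
        (S.faceClass {p ∈ S.NC .a .a .t .t | ineq₃ p = 0}) ∧
      Disjoint (S.faceClass {p ∈ S.NC .a .a .t .t | ineq₂ p = 0})
        (S.faceClass {p ∈ S.NC .a .a .t .t | ineq₃ p = 0}) ∧
      (S.faceClass {p ∈ S.NC .a .a .t .t | ineq₁ p = 0}).ncard = 144 ∧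
      (S.faceClass {p ∈ S.NC .a .a .t .t | ineq₂ p = 0}).ncard = 144 ∧
      (S.faceClass {p ∈ S.NC .a .a .t .t | ineq₃ p = 0}).ncard = 48) ∧
    -- with the roles of the parties exchanged, the hierarchy reads with the first two letters
    -- exchanged
    (∀ (dA dB : Type) [Fintype dA] [Fintype dB] [DecidableEq dA] [DecidableEq dB]
      (S : BellScenario (Fin 2) (Fin 2) (Fin 4) (Fin 3) dA dB),
      HasShape S.N (antipodal cubeAxis) → HasShape S.M (antipodal octahedronAxis) →
      (S.O .a .a .t .t = S.O .a .t .t .t ∧ S.O .t .a .t .t ⊂ S.O .a .t .t .t ∧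
        S.O .t .a .t .t = S.O .t .t .t .t) ∧
      (S.NC .a .a .t .t = S.NC .a .t .t .t ∧ S.NC .a .t .t .t ⊂ S.NC .t .a .t .t ∧
        S.NC .t .a .t .t = S.NC .t .t .t .t)) ∧
    -- isotropic states with the stated qubit measurements
    (∀ (p : ℝ) (hp : p ∈ Set.Icc (0 : ℝ) 1),
      HasShape (octCubeScenario p hp).N (antipodal octahedronAxis) ∧
      HasShape (octCubeScenario p hp).M (antipodal cubeAxis) ∧
      (ineq₃ (octCubeScenario p hp).stats < 0 ↔ 1 / Real.sqrt 3 < p) ∧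
      (1 / Real.sqrt 3 < p →
        (octCubeScenario p hp).stats ∉ (octCubeScenario p hp).NC .a .a .t .t)) := by
  refine ⟨?_, ?_, ?_⟩
  · intro dA dB _ _ _ _ S hN hM
    have hP := S.NC_eq_octCubePolytope hN hM
    obtain ⟨hO, hNC⟩ := S.hierarchy_octahedron_cube hN hM
    refine ⟨hO, hNC, ⟨Set.range vertex, Set.finite_range _, hP⟩, ?_⟩
    rw [hP, setOf_ineq_eq fun p hp => ineq₁_eq hp, setOf_ineq_eq fun p hp => ineq₂_eq hp,
      setOf_ineq_eq fun p hp => ineq₃_eq hp]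
    simp only [S.faceClass_facetOf hN hM]
    refine ⟨affDim_octCubePolytope, ncard_nontrivialFacets, fun p hp => ?_, ?_, ?_, ?_, ?_,
      disjoint_image_facetOf not_samePattern₁₂, disjoint_image_facetOf not_samePattern₁₃,
      disjoint_image_facetOf not_samePattern₂₃, ncard_class₁, ncard_class₂, ncard_class₃⟩
    · rw [ineq₁_eq hp, ineq₂_eq hp, ineq₃_eq hp]
      exact ⟨facetForm_nonneg _ hp, facetForm_nonneg _ hp, facetForm_nonneg _ hp⟩
    · rw [nontrivialFacets_octCubePolytope]
      exact ⟨label₁, by decide, rfl⟩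
    · rw [nontrivialFacets_octCubePolytope]
      exact ⟨label₂, by decide, rfl⟩
    · rw [nontrivialFacets_octCubePolytope]
      exact ⟨label₃, by decide, rfl⟩
    · rw [nontrivialFacets_octCubePolytope, ← Set.image_union, ← Set.image_union]
      congr 1
      ext τ
      exact (twoAxes_iff τ).trans or_assoc.symm
  · intro dA dB _ _ _ _ S hN hM
    exact S.hierarchy_cube_octahedron hN hM
  · intro p hp
    have hN := octCubeScenario_hasShape_left p hp
    have hM := octCubeScenario_hasShape_right p hp
    refine ⟨hN, hM, ineq₃_octCubeScenario_neg_iff p hp, fun h hmem => ?_⟩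
    rw [BellScenario.NC_eq_octCubePolytope _ hN hM] at hmem
    have h1 := (ineq₃_octCubeScenario_neg_iff p hp).2 h
    rw [ineq₃_eq hmem] at h1
    exact absurd (facetForm_nonneg label₃ hmem) (not_le.2 h1)
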